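/- Let $\mathbb F_q$ be a finite field of characteristic $2$, let $\phi\in\mathbb F_q[x]$ have degree $3$, and let $F=\mathbb F_q(x,y)$ with $y^2+y=\phi(x)$ be the function field of the elliptic curve $E$. Let $T\subseteq\mathbb F_q$ be a set of $x$-coordinates of affine rational points of $E$, and let $P_m=(\alpha_m,\beta_m)$, $1\le m\le n$, be the distinct rational points of $E$ whose $x$-coordinate lies in $T$; write $n=2s$, $D=P_1+\dots+P_n$. Put $t=\prod_{a\in T}(x-a)$, $\omega=dx/t$ and $\gamma_m=\mathrm{res}_{P_m}(\omega)$. Let $3\le k\le n-2$ and $\eta\in\mathbb F_q^*$. Write $$M_j(i)=\sum_{m=1}^n\gamma_m\alpha_m^{i}\beta_m^{j},$$ and for $r\ge1$ let $G(D,\omega,rO)$ be the matrix with $n$ columns whose rows are $(\gamma_m\alpha_m^i)_m$ for $0\le i\le\lfloor r/2\rfloor$ and $(\gamma_m\alpha_m^j\beta_m)_m$ for $0\le j\le\lfloor (r-3)/2\rfloor$. For a code $\mathcal C\subseteq\mathbb F_q^n$, a parity-check matrix is a matrix whose rows form a basis of the Euclidean dual $\mathcal C^\perp$. Then $M_1(s-1)\neq0$,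 and the following hold. 1. Let $k$ be odd, $0\le\ell\le\frac{k-3}2$, $R=\frac{k-3}2-\ell$, and let $\mathcal C$ be the code of all $(g(P_1),\dots,g(P_n))$ with $$g=\sum_{i=0}^{(k-1)/2}u_ix^i+\sum_{j=0}^{(k-3)/2}v_jx^jy+v_\ell\,\eta\,x^{(k+1)/2},\qquad u_i,v_j\in\mathbb F_q.$$ Define $a_0,\dots,a_R,b_0,\dots,b_R$ by $a_0=1$ and, for $1\le r\le R$, $$b_{r-1}=-\frac{\sum_{j=0}^{r-2}b_jM_1(s-2+r-j)}{M_1(s-1)},\qquad a_r=-\frac{\sum_{i=0}^{r-1}a_iM_1(s-1+r-i)+\sum_{j=0}^{r-2}b_jM_2(s-3+r-j)}{M_1(s-1)},$$ $$b_R=-\frac{M_1(s-1)+\eta\sum_{i=0}^{R}a_iM_0\!\left(s-\ell-1+\tfrac{k+1}2-i\right)+\eta\sum_{j=0}^{R-1}b_jM_1\!\left(s-\ell-3+\tfrac{k+1}2-j\right)}{\eta\,M_1(s-1)}.$$ Then the matrix consisting of the row $(\gamma_mf_1(\alpha_m,\beta_m))_m$ and the rows of $G(D,\omega,(n-k-1)O)$,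 where $$f_1=\sum_{i=0}^{R}a_ix^{s-\ell-1-i}+\sum_{j=0}^{R}b_jx^{s-\ell-3-j}y,$$ is a parity-check matrix of $\mathcal C$. 2. Let $k$ be even, $0\le\ell\le\frac k2$, $R=\frac k2-\ell$, and let $\mathcal C$ be the code of all $(g(P_1),\dots,g(P_n))$ with $$g=\sum_{i=0}^{k/2}u_ix^i+\sum_{j=0}^{(k-4)/2}v_jx^jy+u_\ell\,\eta\,x^{(k-2)/2}y,\qquad u_i,v_j\in\mathbb F_q.$$ Define $e_0,\dots,e_R,h_0,\dots,h_R$ by $h_0=1$ and, for $1\le r\le R$, $$h_r=-\frac{\sum_{j=0}^{r-1}h_jM_1(s-1+r-j)}{M_1(s-1)},\qquad e_{r-1}=-\frac{\sum_{i=0}^{r-2}e_iM_1(s-2+r-i)+\sum_{j=0}^{r-2}h_jM_2(s-3+r-j)}{M_1(s-1)},$$ $$e_R=-\frac{M_1(s-1)+\eta\sum_{i=0}^{R-1}e_iM_1\!\left(s-\ell-i+\tfrac{k-2}2\right)+\eta\sum_{j=0}^{R-1}h_jM_2\!\left(s-\ell-1-j+\tfrac{k-2}2\right)}{\eta\,M_1(s-1)}.$$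 Then the matrix consisting of the row $(\gamma_mf_2(\alpha_m,\beta_m))_m$ and the rows of $G(D,\omega,(n-k-1)O)$, where $$f_2=\sum_{j=0}^{R}h_jx^{s-\ell-1-j}y+\sum_{i=0}^{R}e_ix^{s-\ell-i},$$ is a parity-check matrix of $\mathcal C$. -/

import Mathlib

open scoped KaehlerDifferential

namespace TECC

section FunctionField

variable {K F : Type*} [Field K] [Field F] [Algebra K F]

/-- The local ring at the point `(α, β)` of the plane curve with generic point `(x, y)`: the
elements of the function field that are quotients `p(x, y) / q(x, y)` with `q(α, β) ≠ 0`. -/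
def localRingAt (x y : F) (α β : K) : Subalgebra K F where
  carrier := {z | ∃ p q : MvPolynomial (Fin 2) K, MvPolynomial.eval ![α, β] q ≠ 0 ∧
    z * MvPolynomial.aeval ![x, y] q = MvPolynomial.aeval ![x, y] p}
  mul_mem' := by
    rintro z w ⟨p, q, hq, h⟩ ⟨p', q', hq', h'⟩
    refine ⟨p * p', q * q', by rw [map_mul]; exact mul_ne_zero hq hq', ?_⟩
    rw [map_mul, map_mul, ← h, ← h']; ring
  add_mem' := by
    rintro z w ⟨p, q, hq, h⟩ ⟨p', q', hq', h'⟩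
    refine ⟨p * q' + p' * q, q * q', by rw [map_mul]; exact mul_ne_zero hq hq', ?_⟩
    rw [map_mul, map_add, map_mul, map_mul, ← h, ← h']; ring
  algebraMap_mem' := by
    intro r
    exact ⟨MvPolynomial.C r, 1, by simp, by simp⟩

/-- `π` generates the ideal of non-units of the local ring `O`, a subring of the field `F`
(the inverse is taken in `F`, where `0⁻¹ = 0`). -/
def IsUniformizer (O : Subalgebra K F) (π : F) : Prop :=
  π ∈ O ∧ π⁻¹ ∉ O ∧ ∀ z ∈ O, z⁻¹ ∉ O → z / π ∈ O

/-- `a` is the residue of the differential `ω` at the rational point with local ring `O`: for a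
local uniformizer `π` one has `ω = u dπ`, and `a` is the coefficient of `π⁻¹` in the `π`-adic
expansion of `u`, whose principal part is `∑_{i ≤ N} cᵢ π^{-(i+1)}`. -/
def HasResidue (O : Subalgebra K F) (ω : Ω[F⁄K]) (a : K) : Prop :=
  ∃ π u : F, IsUniformizer O π ∧ ω = u • KaehlerDifferential.D K F π ∧
    ∃ (N : ℕ) (c : ℕ → K), c 0 = a ∧
      u - ∑ i ∈ Finset.range (N + 1), algebraMap K F (c i) * (π⁻¹) ^ (i + 1) ∈ O

end FunctionField

section Codes

variable {K : Type*} [Field K]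

/-- The polynomial `∑_{i < p} aᵢ x^i + ∑_{j < r} bⱼ x^j y` in the two variables `x, y`. -/
noncomputable def xyPoly (p r : ℕ) (a b : ℕ → K) : MvPolynomial (Fin 2) K :=
  ∑ i ∈ Finset.range p, MvPolynomial.C (a i) * MvPolynomial.X 0 ^ i +
    ∑ j ∈ Finset.range r, MvPolynomial.C (b j) * MvPolynomial.X 0 ^ j * MvPolynomial.X 1

theorem xyPoly_add (p r : ℕ) (a b a' b' : ℕ → K) :
    xyPoly p r (a + a') (b + b') = xyPoly p r a b + xyPoly p r a' b' := by
  simp only [xyPoly, Pi.add_apply, map_add, add_mul, Finset.sum_add_distrib]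
  ring

theorem xyPoly_smul (p r : ℕ) (c : K) (a b : ℕ → K) :
    xyPoly p r (c • a) (c • b) = c • xyPoly p r a b := by
  simp only [xyPoly, Pi.smul_apply, smul_eq_mul, map_mul, MvPolynomial.smul_eq_C_mul, mul_add,
    Finset.mul_sum, mul_assoc]

/-- The defining set for odd `k`:
`∑_{i ≤ (k-1)/2} aᵢ x^i + ∑_{j ≤ (k-3)/2} bⱼ x^j y + b_ℓ η x^{(k+1)/2}`. -/
noncomputable def oddDefiningSet (k ℓ : ℕ) (η : K) : Submodule K (MvPolynomial (Fin 2) K) where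
  carrier := {g | ∃ a b : ℕ → K, g = xyPoly ((k - 1) / 2 + 1) ((k - 3) / 2 + 1) a b +
    MvPolynomial.C (b ℓ * η) * MvPolynomial.X 0 ^ ((k + 1) / 2)}
  zero_mem' := ⟨0, 0, by simp [xyPoly]⟩
  add_mem' := by
    rintro _ _ ⟨a, b, rfl⟩ ⟨a', b', rfl⟩
    refine ⟨a + a', b + b', ?_⟩
    rw [xyPoly_add, Pi.add_apply, add_mul, map_add]; ring
  smul_mem' := by
    rintro c _ ⟨a, b, rfl⟩
    refine ⟨c • a, c • b, ?_⟩
    rw [xyPoly_smul, smul_add, MvPolynomial.smul_eq_C_mul (_ * _), ← mul_assoc, ← map_mul,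
      Pi.smul_apply, smul_eq_mul, mul_assoc c]

/-- The defining set for even `k ≥ 4`:
`∑_{i ≤ k/2} aᵢ x^i + ∑_{j ≤ (k-4)/2} bⱼ x^j y + a_ℓ η x^{(k-2)/2} y`. -/
noncomputable def evenDefiningSet (k ℓ : ℕ) (η : K) : Submodule K (MvPolynomial (Fin 2) K) where
  carrier := {g | ∃ a b : ℕ → K, g = xyPoly (k / 2 + 1) ((k - 4) / 2 + 1) a b +
    MvPolynomial.C (a ℓ * η) * (MvPolynomial.X 0 ^ ((k - 2) / 2) * MvPolynomial.X 1)}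
  zero_mem' := ⟨0, 0, by simp [xyPoly]⟩
  add_mem' := by
    rintro _ _ ⟨a, b, rfl⟩ ⟨a', b', rfl⟩
    refine ⟨a + a', b + b', ?_⟩
    rw [xyPoly_add, Pi.add_apply, add_mul, map_add]; ring
  smul_mem' := by
    rintro c _ ⟨a, b, rfl⟩
    refine ⟨c • a, c • b, ?_⟩
    rw [xyPoly_smul, smul_add, MvPolynomial.smul_eq_C_mul (_ * _), ← mul_assoc, ← map_mul,
      Pi.smul_apply, smul_eq_mul, mul_assoc c]

variable {n : ℕ}

/-- The evaluation map `g ↦ (g(α₁, β₁), …, g(αₙ, βₙ))`. -/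
noncomputable def evalMap (α β : Fin n → K) : MvPolynomial (Fin 2) K →ₗ[K] (Fin n → K) :=
  LinearMap.pi fun m => (MvPolynomial.aeval ![α m, β m]).toLinearMap

/-- The twisted elliptic curve code (one twist) of odd dimension `k`. -/
noncomputable def oddCode (α β : Fin n → K) (k ℓ : ℕ) (η : K) : Submodule K (Fin n → K) :=
  (oddDefiningSet k ℓ η).map (evalMap α β)

/-- The twisted elliptic curve code (one twist) of even dimension `k`. -/
noncomputable def evenCode (α β : Fin n → K) (k ℓ : ℕ) (η : K) : Submodule K (Fin n → K) :=
  (evenDefiningSet k ℓ η).map (evalMap α β)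

/-- The dual code with respect to the Euclidean inner product. -/
def dualCode (C : Submodule K (Fin n → K)) : Submodule K (Fin n → K) where
  carrier := {v | ∀ c ∈ C, ∑ m, c m * v m = 0}
  zero_mem' := by simp
  add_mem' := by
    intro v w hv hw c hc
    simp only [Pi.add_apply, mul_add, Finset.sum_add_distrib, hv c hc, hw c hc, add_zero]
  smul_mem' := by
    intro r v hv c hc
    simp only [Pi.smul_apply, smul_eq_mul, mul_left_comm _ r, ← Finset.mul_sum, hv c hc, mul_zero]

/-- `H` is a parity-check matrix of `C`: its rows form a basis of the dual code. -/
def IsParityCheckMatrix {ι : Type*} (H : Matrix ι (Fin n) K) (C : Submodule K (Fin n → K)) :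
    Prop :=
  LinearIndependent K (fun i => H i) ∧ Submodule.span K (Set.range fun i => H i) = dualCode C

/-- The matrix `G(D, ω, rO)`, `r ≥ 1`, with rows `(γₘ αₘ^i)ₘ` for `0 ≤ i ≤ ⌊r/2⌋` and
`(γₘ αₘ^j βₘ)ₘ` for `0 ≤ j ≤ ⌊(r-3)/2⌋ = ⌊(r-1)/2⌋ - 1`. -/
def gMatrix (γ α β : Fin n → K) (r : ℕ) :
    Matrix (Fin (r / 2 + 1) ⊕ Fin ((r - 1) / 2)) (Fin n) K :=
  Matrix.fromRows (Matrix.of fun i m => γ m * α m ^ (i : ℕ))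
    (Matrix.of fun j m => γ m * α m ^ (j : ℕ) * β m)

/-- `G(D, ω, rO)` with the additional row `(γₘ f(αₘ, βₘ))ₘ`. -/
noncomputable def extendedMatrix (γ α β : Fin n → K) (f : MvPolynomial (Fin 2) K) (r : ℕ) :
    Matrix (Unit ⊕ (Fin (r / 2 + 1) ⊕ Fin ((r - 1) / 2))) (Fin n) K :=
  Matrix.fromRows (Matrix.of fun _ m => γ m * MvPolynomial.eval ![α m, β m] f)
    (gMatrix γ α β r)

/-- The sum `∑ₘ γₘ αₘ^i βₘ^j`. -/
def powerSum (γ α β : Fin n → K) (i j : ℕ) : K := ∑ m, γ m * α m ^ i * β m ^ j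

/-- The recursion for the coefficients `a₀, …, a_R, b₀, …, b_R`, `R = (k-3)/2 - ℓ`, for odd `k`. -/
def OddRecursion (γ α β : Fin n → K) (s k ℓ : ℕ) (η : K) (a b : ℕ → K) : Prop :=
  a 0 = 1 ∧
  (∀ r ∈ Finset.Icc 1 ((k - 3) / 2 - ℓ),
    a r = -(∑ i ∈ Finset.range r, a i * powerSum γ α β (s + r - 1 - i) 1 +
        ∑ j ∈ Finset.range (r - 1), b j * powerSum γ α β (s + r - 3 - j) 2) /
      powerSum γ α β (s - 1) 1) ∧
  (∀ r ∈ Finset.Icc 1 ((k - 3) / 2 - ℓ),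
    b (r - 1) = -(∑ j ∈ Finset.range (r - 1), b j * powerSum γ α β (s + r - 2 - j) 1) /
      powerSum γ α β (s - 1) 1) ∧
  b ((k - 3) / 2 - ℓ) =
    -(powerSum γ α β (s - 1) 1 +
      η * ∑ i ∈ Finset.range ((k - 3) / 2 - ℓ + 1),
        a i * powerSum γ α β (s - ℓ - 1 + (k + 1) / 2 - i) 0 +
      η * ∑ j ∈ Finset.range ((k - 3) / 2 - ℓ),
        b j * powerSum γ α β (s - ℓ - 3 + (k + 1) / 2 - j) 1) /
    (η * powerSum γ α β (s - 1) 1)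

/-- `f₁ = ∑_{i ≤ R} aᵢ x^{s-ℓ-1-i} + ∑_{j ≤ R} bⱼ x^{s-ℓ-3-j} y`, `R = (k-3)/2 - ℓ`. -/
noncomputable def oddPoly (s k ℓ : ℕ) (a b : ℕ → K) : MvPolynomial (Fin 2) K :=
  ∑ i ∈ Finset.range ((k - 3) / 2 - ℓ + 1),
      MvPolynomial.C (a i) * MvPolynomial.X 0 ^ (s - ℓ - 1 - i) +
    ∑ j ∈ Finset.range ((k - 3) / 2 - ℓ + 1),
      MvPolynomial.C (b j) * MvPolynomial.X 0 ^ (s - ℓ - 3 - j) * MvPolynomial.X 1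

/-- The recursion for the coefficients `e₀, …, e_R, h₀, …, h_R`, `R = k/2 - ℓ`, for even `k`. -/
def EvenRecursion (γ α β : Fin n → K) (s k ℓ : ℕ) (η : K) (e h : ℕ → K) : Prop :=
  h 0 = 1 ∧
  (∀ r ∈ Finset.Icc 1 (k / 2 - ℓ),
    h r = -(∑ j ∈ Finset.range r, h j * powerSum γ α β (s + r - 1 - j) 1) /
      powerSum γ α β (s - 1) 1) ∧
  (∀ r ∈ Finset.Icc 1 (k / 2 - ℓ),
    e (r - 1) = -(∑ i ∈ Finset.range (r - 1), e i * powerSum γ α β (s + r - 2 - i) 1 +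
        ∑ j ∈ Finset.range (r - 1), h j * powerSum γ α β (s + r - 3 - j) 2) /
      powerSum γ α β (s - 1) 1) ∧
  e (k / 2 - ℓ) =
    -(powerSum γ α β (s - 1) 1 +
      η * ∑ i ∈ Finset.range (k / 2 - ℓ),
        e i * powerSum γ α β (s - ℓ + (k - 2) / 2 - i) 1 +
      η * ∑ j ∈ Finset.range (k / 2 - ℓ),
        h j * powerSum γ α β (s - ℓ - 1 + (k - 2) / 2 - j) 2) /
    (η * powerSum γ α β (s - 1) 1)

/-- `f₂ = ∑_{j ≤ R} hⱼ x^{s-ℓ-1-j} y + ∑_{i ≤ R} eᵢ x^{s-ℓ-i}`, `R = k/2 - ℓ`. -/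
noncomputable def evenPoly (s k ℓ : ℕ) (e h : ℕ → K) : MvPolynomial (Fin 2) K :=
  ∑ j ∈ Finset.range (k / 2 - ℓ + 1),
      MvPolynomial.C (h j) * MvPolynomial.X 0 ^ (s - ℓ - 1 - j) * MvPolynomial.X 1 +
    ∑ i ∈ Finset.range (k / 2 - ℓ + 1),
      MvPolynomial.C (e i) * MvPolynomial.X 0 ^ (s - ℓ - i)

end Codes

end TECC

/-! In characteristic two, differentiating `y² + y = f(x)` gives `dy = f'(x) dx`. So there is a
derivation `δ` with `δ x = 1` that preserves every local ring at an affine point. Hence `dx` has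
neither zero nor pole there, and the residue of `dx / ∏ (x - a)` at a point over `α` is the Lagrange
weight `1 / ∏_{c ≠ α} (α - c)` (`residue_eq_prod_inv`).

The points over `T` come in pairs `(a, b)`, `(a, b + 1)`. Over such a pair `1`, `y`, `y²` sum to
`0`, `1`, `1`. The weighted pairing of `A + B y` with `C + D y` therefore collapses to `L(AD + BC +
BD)`, where `L = topCoeff T` reads off the coefficient of `X^(s-1)` on polynomials of degree below
`s = |T|` (`sum_weighted_mul_eq`). In particular `M₀ = 0` and `M₁(i) = M₂(i) = L(X^i)`, which is `0`
for `i < s - 1` and `1` for `i = s - 1`.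

Pairing the extra row with the basis of the code thus gives a triangular system with unit diagonal.
The recursions solve its equations one at a time, and the last coefficient, `b_R` or `e_R`, is fixed
by the twisted basis element. The rows of `gMatrix` are orthogonal to the code by degree alone.

A function `A + B y` with both degrees below `s` that vanishes at all points is zero. This gives `n
- k` independent rows and `k` independent codewords, and counting dimensions finishes the proof
(`isParityCheckMatrix_of_card`). -/

namespace TECC

/-! ### The coordinate ring, its relations and the derivation `d/dx`. -/

section Curve

variable {K F : Type*} [Field K] [Field F] [Algebra K F]

/-- The polynomial `Y² + Y - f(X)` defining the curve. -/
noncomputable def curvePoly (f : Polynomial K) : MvPolynomial (Fin 2) K :=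
  MvPolynomial.X 1 ^ 2 + MvPolynomial.X 1 - Polynomial.aeval (MvPolynomial.X 0) f

theorem aeval_aeval_X_zero {R : Type*} [CommRing R] [Algebra K R] (p : Polynomial K)
    (v : Fin 2 → R) :
    MvPolynomial.aeval v (Polynomial.aeval (MvPolynomial.X 0 : MvPolynomial (Fin 2) K) p) =
      Polynomial.aeval (v 0) p := by
  rw [← Polynomial.aeval_algHom_apply, MvPolynomial.aeval_X]

/-- Division with remainder by `Y² + Y - f`, which is monic in `Y`. -/
theorem exists_reduced (f : Polynomial K) (r : MvPolynomial (Fin 2) K) :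
    ∃ (A B : Polynomial K) (s : MvPolynomial (Fin 2) K),
      r = Polynomial.aeval (MvPolynomial.X 0) A +
        Polynomial.aeval (MvPolynomial.X 0) B * MvPolynomial.X 1 + curvePoly f * s := by
  induction r using MvPolynomial.induction_on with
  | C a => exact ⟨Polynomial.C a, 0, 0, by simp [MvPolynomial.algebraMap_eq]⟩
  | add p q hp hq =>
    obtain ⟨A, B, s, hp⟩ := hp
    obtain ⟨A', B', s', hq⟩ := hq
    refine ⟨A + A', B + B', s + s', ?_⟩
    rw [hp, hq, map_add, map_add]; ring
  | mul_X p i hp =>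
    obtain ⟨A, B, s, hp⟩ := hp
    match i with
    | 0 =>
      refine ⟨A * Polynomial.X, B * Polynomial.X, s * MvPolynomial.X 0, ?_⟩
      rw [hp]; simp only [map_mul, Polynomial.aeval_X]; ring
    | 1 =>
      refine ⟨B * f, A - B, s * MvPolynomial.X 1 + Polynomial.aeval (MvPolynomial.X 0) B, ?_⟩
      rw [hp]; simp only [map_mul, map_sub, curvePoly]; ring

/-- The hypothesis says that the norm of `A + B y` vanishes. If `B ≠ 0`, the right side has odd
degree `2 deg B + 3`. The left side has degree at most `2 deg B`, or exactly the even number `2 deg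
A`. -/
theorem eq_zero_of_norm_eq_zero {f A B : Polynomial K} (hf : f.natDegree = 3)
    (h : A ^ 2 - A * B = B ^ 2 * f) : A = 0 ∧ B = 0 := by
  have hf0 : f ≠ 0 := by rintro rfl; simp at hf
  by_cases hB : B = 0
  · subst hB; simpa using h
  exfalso
  have hdeg : (B ^ 2 * f).natDegree = 2 * B.natDegree + 3 := by
    rw [Polynomial.natDegree_mul (pow_ne_zero _ hB) hf0, Polynomial.natDegree_pow, hf]
  rcases le_or_gt A.natDegree B.natDegree with hle | hlt
  · have h1 : (A ^ 2 - A * B).natDegree ≤ 2 * B.natDegree := by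
      refine (Polynomial.natDegree_sub_le _ _).trans (max_le ?_ ?_)
      · rw [Polynomial.natDegree_pow]; omega
      · exact Polynomial.natDegree_mul_le.trans (by omega)
    rw [h, hdeg] at h1; omega
  · have h1 : (A ^ 2 - A * B).natDegree = 2 * A.natDegree := by
      rw [Polynomial.natDegree_sub_eq_left_of_natDegree_lt, Polynomial.natDegree_pow]
      rw [Polynomial.natDegree_pow]
      exact Polynomial.natDegree_mul_le.trans_lt (by omega)
    rw [h, hdeg] at h1; omega

variable {f : Polynomial K} {x y : F}

theorem aeval_curvePoly (hxy : y ^ 2 + y = Polynomial.aeval x f) :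
    MvPolynomial.aeval ![x, y] (curvePoly f) = 0 := by
  simp [curvePoly, aeval_aeval_X_zero, hxy]

/-- Every polynomial relation between `x` and `y` is a multiple of the equation of the curve. -/
theorem exists_eq_curvePoly_mul (hf : f.natDegree = 3) (hx : Transcendental K x)
    (hxy : y ^ 2 + y = Polynomial.aeval x f) {r : MvPolynomial (Fin 2) K}
    (hr : MvPolynomial.aeval ![x, y] r = 0) : ∃ s, r = curvePoly f * s := by
  obtain ⟨A, B, s, h⟩ := exists_reduced f r
  have h0 : Polynomial.aeval x A + Polynomial.aeval x B * y = 0 := by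
    rw [h] at hr
    simpa [aeval_curvePoly hxy, aeval_aeval_X_zero] using hr
  have h1 : A ^ 2 - A * B = B ^ 2 * f := by
    refine transcendental_iff_injective.mp hx ?_
    simp only [map_sub, map_mul, map_pow, ← hxy]
    -- The factor is the conjugate of `A + B y` under `y ↦ -1 - y`, so the product is the norm.
    linear_combination (Polynomial.aeval x A - Polynomial.aeval x B * y - Polynomial.aeval x B) * h0
  obtain ⟨rfl, rfl⟩ := eq_zero_of_norm_eq_zero hf h1
  exact ⟨s, by simpa using h⟩

theorem eval_eq_zero_of_aeval_eq_zero (hf : f.natDegree = 3) (hx : Transcendental K x)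
    (hxy : y ^ 2 + y = Polynomial.aeval x f) {α β : K} (hP : β ^ 2 + β = f.eval α)
    {r : MvPolynomial (Fin 2) K} (hr : MvPolynomial.aeval ![x, y] r = 0) :
    MvPolynomial.eval ![α, β] r = 0 := by
  obtain ⟨s, rfl⟩ := exists_eq_curvePoly_mul hf hx hxy hr
  have : MvPolynomial.aeval ![α, β] (curvePoly f) = 0 :=
    aeval_curvePoly (by rw [hP, Polynomial.coe_aeval_eq_eval])
  rw [map_mul, show MvPolynomial.eval ![α, β] (curvePoly f) = 0 from this, zero_mul]

theorem exists_fraction (hF : IntermediateField.adjoin K {x, y} = ⊤) (z : F) :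
    ∃ p q : MvPolynomial (Fin 2) K, MvPolynomial.aeval ![x, y] q ≠ 0 ∧
      z * MvPolynomial.aeval ![x, y] q = MvPolynomial.aeval ![x, y] p := by
  have hz : z ∈ IntermediateField.adjoin K (Set.range ![x, y]) := by
    have : Set.range ![x, y] = {x, y} := by simp [Set.pair_comm]
    rw [this, hF]; trivial
  obtain ⟨p, q, h⟩ := (IntermediateField.mem_adjoin_range_iff K _ _).mp hz
  by_cases hq : MvPolynomial.aeval ![x, y] q = 0
  · exact ⟨0, 1, by simp, by simp [h, hq]⟩
  · exact ⟨p, q, hq, by rw [h, div_mul_cancel₀ _ hq]⟩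

/-- A derivation from the polynomial ring that annihilates all relations extends to the field. -/
theorem exists_derivation_extension {σ : Type*} (v : σ → F)
    (hv : ∀ z : F, ∃ p q : MvPolynomial σ K, MvPolynomial.aeval v q ≠ 0 ∧
      z * MvPolynomial.aeval v q = MvPolynomial.aeval v p)
    (d : MvPolynomial σ K →ₗ[K] F)
    (hmul : ∀ p q, d (p * q) = MvPolynomial.aeval v p * d q + MvPolynomial.aeval v q * d p)
    (hd : ∀ r, MvPolynomial.aeval v r = 0 → d r = 0) :
    ∃ δ : Derivation K F F, ∀ p, δ (MvPolynomial.aeval v p) = d p := by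
  choose p q hq hpq using hv
  -- The quotient rule; `key` shows that it does not depend on the chosen fraction, since `d` kills
  -- the relation between two fractions of the same element.
  let g : F → F := fun z => (d (p z) - z * d (q z)) / MvPolynomial.aeval v (q z)
  have key : ∀ (z : F) (P Q : MvPolynomial σ K), MvPolynomial.aeval v Q ≠ 0 →
      z * MvPolynomial.aeval v Q = MvPolynomial.aeval v P →
      g z * MvPolynomial.aeval v Q = d P - z * d Q := by
    intro z P Q hQ hPQ
    have h0 := hd (p z * Q - P * q z) (by
      rw [map_sub, map_mul, map_mul, ← hPQ, ← hpq z]; ring)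
    rw [map_sub, hmul, hmul, ← hPQ, ← hpq z] at h0
    simp only [g]
    rw [div_mul_eq_mul_div, div_eq_iff (hq z)]
    linear_combination h0
  have d1 : d 1 = 0 := by simpa using hmul 1 1
  have hg : ∀ P, g (MvPolynomial.aeval v P) = d P := fun P => by
    simpa [d1] using key (MvPolynomial.aeval v P) P 1 (by simp) (by simp)
  have hadd : ∀ z w, g (z + w) = g z + g w := by
    intro z w
    have hne := mul_ne_zero (hq z) (hq w)
    have h := key (z + w) (p z * q w + p w * q z) (q z * q w) (by rwa [map_mul])
      (by rw [map_mul, map_add, map_mul, map_mul, ← hpq z, ← hpq w]; ring)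
    have h1 := key z _ _ (hq z) (hpq z)
    have h2 := key w _ _ (hq w) (hpq w)
    refine mul_right_cancel₀ hne ?_
    rw [← map_mul, h, map_mul (MvPolynomial.aeval v), map_add, hmul, hmul, hmul, ← hpq z, ← hpq w]
    linear_combination -MvPolynomial.aeval v (q w) * h1 - MvPolynomial.aeval v (q z) * h2
  have hleib : ∀ z w, g (z * w) = z * g w + w * g z := by
    intro z w
    have hne := mul_ne_zero (hq z) (hq w)
    have h := key (z * w) (p z * p w) (q z * q w) (by rwa [map_mul])
      (by rw [map_mul, map_mul, ← hpq z, ← hpq w]; ring)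
    have h1 := key z _ _ (hq z) (hpq z)
    have h2 := key w _ _ (hq w) (hpq w)
    refine mul_right_cancel₀ hne ?_
    rw [← map_mul, h, map_mul (MvPolynomial.aeval v), hmul, hmul, ← hpq z, ← hpq w]
    linear_combination -MvPolynomial.aeval v (q w) * w * h1 - MvPolynomial.aeval v (q z) * z * h2
  have hsmul : ∀ (c : K) z, g (c • z) = c • g z := by
    intro c z
    have hc : g (algebraMap K F c) = 0 := by
      have := hg (MvPolynomial.C c)
      rw [MvPolynomial.algHom_C] at this
      rw [this, ← mul_one (MvPolynomial.C c), ← MvPolynomial.smul_eq_C_mul, map_smul, d1,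
        smul_zero]
    rw [Algebra.smul_def, hleib, hc, mul_zero, add_zero, Algebra.smul_def]
  exact ⟨Derivation.mk' ⟨⟨g, hadd⟩, hsmul⟩ hleib, hg⟩

/-- On the function field of `y² + y = f(x)` in characteristic two there is a derivation `δ`
with `δ x = 1`, and it preserves the coordinate ring. -/
theorem exists_derivation [CharP K 2] (hf : f.natDegree = 3) (hx : Transcendental K x)
    (hxy : y ^ 2 + y = Polynomial.aeval x f) (hF : IntermediateField.adjoin K {x, y} = ⊤) :
    ∃ δ : Derivation K F F, δ x = 1 ∧ ∀ p : MvPolynomial (Fin 2) K, ∃ p' : MvPolynomial (Fin 2) K,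
      δ (MvPolynomial.aeval ![x, y] p) = MvPolynomial.aeval ![x, y] p' := by
  let D : Derivation K (MvPolynomial (Fin 2) K) (MvPolynomial (Fin 2) K) :=
    MvPolynomial.mkDerivation K ![1, Polynomial.aeval (MvPolynomial.X 0) (Polynomial.derivative f)]
  -- `D` sends the equation to `2Y f' + f' - f'`, which is zero in characteristic two.
  have hD : D (curvePoly f) = 0 := by
    have h2 : (2 : MvPolynomial (Fin 2) K) = 0 := CharTwo.two_eq_zero
    rw [curvePoly, map_sub, map_add, Derivation.leibniz_pow, Derivation.map_aeval]
    simp [D, MvPolynomial.mkDerivation_X, h2]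
  obtain ⟨δ, hδ⟩ := exists_derivation_extension ![x, y] (exists_fraction hF)
    ((MvPolynomial.aeval ![x, y]).toLinearMap ∘ₗ D.toLinearMap)
    (fun p q => by simp [Derivation.leibniz]) (fun r hr => by
      obtain ⟨s, rfl⟩ := exists_eq_curvePoly_mul hf hx hxy hr
      simp [Derivation.leibniz, hD, aeval_curvePoly hxy])
  refine ⟨δ, ?_, fun p => ⟨D p, by rw [hδ]; rfl⟩⟩
  have := hδ (MvPolynomial.X 0)
  simpa [D, MvPolynomial.mkDerivation_X] using this

theorem derivation_mem_localRingAt {δ : Derivation K F F}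
    (hδ : ∀ p : MvPolynomial (Fin 2) K, ∃ p' : MvPolynomial (Fin 2) K,
      δ (MvPolynomial.aeval ![x, y] p) = MvPolynomial.aeval ![x, y] p')
    {α β : K} {z : F} (hz : z ∈ localRingAt x y α β) : δ z ∈ localRingAt x y α β := by
  obtain ⟨p, q, hq, h⟩ := hz
  obtain ⟨p', hp'⟩ := hδ p
  obtain ⟨q', hq'⟩ := hδ q
  refine ⟨q * p' - p * q', q ^ 2, by rw [map_pow]; exact pow_ne_zero _ hq, ?_⟩
  have h1 := congrArg δ h
  rw [Derivation.leibniz, hp', hq', smul_eq_mul, smul_eq_mul] at h1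
  rw [map_pow, map_sub, map_mul, map_mul, ← h, ← h1]; ring

theorem aeval_mem_localRingAt (α β : K) (p : MvPolynomial (Fin 2) K) :
    MvPolynomial.aeval ![x, y] p ∈ localRingAt x y α β :=
  ⟨p, 1, by simp, by simp⟩

/-- If `(x - α)⁻¹ = p/q`, then `q - (X - α) p` is a relation between `x` and `y`, so it vanishes at
the point and forces `q(α, β) = 0`. -/
theorem inv_sub_notMem_localRingAt (hf : f.natDegree = 3) (hx : Transcendental K x)
    (hxy : y ^ 2 + y = Polynomial.aeval x f) {α β : K} (hP : β ^ 2 + β = f.eval α) :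
    (x - algebraMap K F α)⁻¹ ∉ localRingAt x y α β := by
  rintro ⟨p, q, hq, h⟩
  have hne : x - algebraMap K F α ≠ 0 := by
    intro h0
    rw [sub_eq_zero] at h0
    exact hx (h0 ▸ isAlgebraic_algebraMap α)
  rw [inv_mul_eq_iff_eq_mul₀ hne] at h
  apply hq
  have := eval_eq_zero_of_aeval_eq_zero hf hx hxy hP
    (r := q - (MvPolynomial.X 0 - MvPolynomial.C α) * p) (by simp [h])
  simpa using this

end Curve

/-! ### Residues of `dx / ∏ (x - a)`. -/

section Residue

variable {K F : Type*} [Field K] [Field F] [Algebra K F]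

/-- A polynomial in `π⁻¹` that lies in a ring containing `π` but not `π⁻¹` is constant. -/
theorem sum_inv_pow_eq_of_mem {O : Subalgebra K F} {π : F} (hπ : π ∈ O) (hπ' : π⁻¹ ∉ O)
    (N : ℕ) (c : ℕ → K)
    (h : ∑ i ∈ Finset.range (N + 1), algebraMap K F (c i) * π⁻¹ ^ i ∈ O) :
    ∑ i ∈ Finset.range (N + 1), algebraMap K F (c i) * π⁻¹ ^ i = algebraMap K F (c 0) := by
  have h0 : π ≠ 0 := by rintro rfl; exact hπ' (by simp)
  induction N with
  | zero => simp
  | succ N ih =>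
    suffices hc : c (N + 1) = 0 by
      rw [Finset.sum_range_succ, hc, map_zero, zero_mul, add_zero] at h ⊢
      exact ih h
    by_contra hc
    apply hπ'
    -- Multiplying by `π ^ N` turns every term except the top one into a polynomial in `π`, which
    -- isolates `π⁻¹`.
    have h1 : π⁻¹ = algebraMap K F (c (N + 1))⁻¹ *
        (π ^ N * ∑ i ∈ Finset.range (N + 1 + 1), algebraMap K F (c i) * π⁻¹ ^ i -
          ∑ i ∈ Finset.range (N + 1), algebraMap K F (c i) * π ^ (N - i)) := by
      have h2 : ∀ i ∈ Finset.range (N + 1),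
          π ^ N * (algebraMap K F (c i) * π⁻¹ ^ i) = algebraMap K F (c i) * π ^ (N - i) := by
        intro i hi
        rw [Finset.mem_range] at hi
        rw [inv_pow, pow_sub₀ _ h0 (by omega)]; ring
      have hc' : algebraMap K F (c (N + 1)) ≠ 0 := by simpa using hc
      rw [Finset.mul_sum, Finset.sum_range_succ, Finset.sum_congr rfl h2, map_inv₀, inv_pow]
      field_simp
      ring
    rw [h1]
    refine O.mul_mem (O.algebraMap_mem _) (O.sub_mem (O.mul_mem (O.pow_mem hπ _) h) ?_)
    exact O.sum_mem fun i _ => O.mul_mem (O.algebraMap_mem _) (O.pow_mem hπ _)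

/-- The residue of `dx / ((x - α) g)` is `1 / g(α)`, for a local ring that is stable under a
derivation `δ` with `δ x = 1`. -/
theorem residue_eq_inv {O : Subalgebra K F} {x g : F} {α a e : K} {δ : Derivation K F F}
    (hδx : δ x = 1) (hδ : ∀ z ∈ O, δ z ∈ O) (hx : x - algebraMap K F α ∈ O)
    (hx' : (x - algebraMap K F α)⁻¹ ∉ O) (hg : g ≠ 0) (hgO : g ∈ O) (he : e ≠ 0)
    (hge : ∃ r ∈ O, g = algebraMap K F e + (x - algebraMap K F α) * r)
    (hres : HasResidue O (((x - algebraMap K F α) * g)⁻¹ • KaehlerDifferential.D K F x) a) :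
    a = e⁻¹ := by
  obtain ⟨π, u, ⟨hπ, hπ', hun⟩, hω, N, c, rfl, hc⟩ := hres
  obtain ⟨r, hr, hge⟩ := hge
  have hπ0 : π ≠ 0 := by rintro rfl; exact hπ' (by simp)
  have hxα : x - algebraMap K F α ≠ 0 := by intro h; exact hx' (by simp [h])
  have hno : ∀ z : K, algebraMap K F z / π ∈ O → z = 0 := by
    intro z hz
    by_contra h
    apply hπ'
    have h' : algebraMap K F z ≠ 0 := by simpa using h
    have : π⁻¹ = algebraMap K F z⁻¹ * (algebraMap K F z / π) := by
      rw [map_inv₀]; field_simp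
    rw [this]
    exact O.mul_mem (O.algebraMap_mem _) hz
  obtain ⟨w, hw, hxw⟩ : ∃ w ∈ O, x - algebraMap K F α = w * π :=
    ⟨_, hun _ hx hx', by field_simp⟩
  have h1 : ((x - algebraMap K F α) * g)⁻¹ = u * δ π := by
    have := congrArg δ.liftKaehlerDifferential hω
    simpa [hδx] using this
  have h2 : 1 = w * δ π + π * δ w := by
    have := congrArg δ hxw
    simpa [hδx] using this
  -- Eliminating `δ π` between `h1` and `h2` gives `u π g ≡ 1` modulo `π`, without knowing that `δ
  -- π` or `w` is a unit.
  have h3 : (u * π) * (1 - π * δ w) * g = 1 := by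
    have h4 : (u * δ π) * ((w * π) * g) = 1 := by
      rw [← h1, ← hxw]; exact inv_mul_cancel₀ (mul_ne_zero hxα hg)
    linear_combination h4 + u * π * g * h2
  -- An element congruent to a nonzero constant modulo `π` is a unit: otherwise it would be
  -- divisible by `π`, and so would the constant.
  have hunit : ∀ z ∈ O, ∀ b : K, b ≠ 0 → (∃ z' ∈ O, z = algebraMap K F b + π * z') → z⁻¹ ∈ O := by
    rintro z hz b hb ⟨z', hz', rfl⟩
    by_contra hcon
    refine hb (hno b ?_)
    have : algebraMap K F b / π = (algebraMap K F b + π * z') / π - z' := by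
      field_simp; ring
    rw [this]
    exact O.sub_mem (hun _ hz hcon) hz'
  have hδw := hδ w hw
  have h1O : 1 - π * δ w ∈ O := O.sub_mem O.one_mem (O.mul_mem hπ hδw)
  have hu1 : (1 - π * δ w)⁻¹ ∈ O := hunit _ h1O 1 one_ne_zero
    ⟨-δ w, O.neg_mem hδw, by rw [map_one]; ring⟩
  have hu2 : g⁻¹ ∈ O := hunit g hgO e he ⟨w * r, O.mul_mem hw hr, by rw [hge, hxw]; ring⟩
  have hne : 1 - π * δ w ≠ 0 := by
    intro h; rw [h] at h3; simp at h3
  have huπ : u * π ∈ O := by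
    have : u * π = (1 - π * δ w)⁻¹ * g⁻¹ := by
      field_simp; linear_combination h3
    rw [this]
    exact O.mul_mem hu1 hu2
  have hsum : ∑ i ∈ Finset.range (N + 1), algebraMap K F (c i) * π⁻¹ ^ i =
      π * ∑ i ∈ Finset.range (N + 1), algebraMap K F (c i) * π⁻¹ ^ (i + 1) := by
    rw [Finset.mul_sum]
    refine Finset.sum_congr rfl fun i _ => ?_
    rw [pow_succ]; field_simp
  have hS := sum_inv_pow_eq_of_mem hπ hπ' N c (by
    have := O.sub_mem huπ (O.mul_mem hπ hc)
    rw [hsum]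
    convert this using 1; ring)
  rw [hsum] at hS
  -- By `hS` the principal part times `π` is the constant `c 0`. So `h3` and `g ≡ e` make the
  -- constant `c 0 * e - 1` divisible by `π`, hence zero.
  refine eq_inv_of_mul_eq_one_left (sub_eq_zero.mp (neg_eq_zero.mp (hno _ ?_)))
  have hkey : algebraMap K F (-(c 0 * e - 1)) / π =
      (u - ∑ i ∈ Finset.range (N + 1), algebraMap K F (c i) * π⁻¹ ^ (i + 1)) * g +
        algebraMap K F (c 0) * (w * r) - u * π * g * δ w := by
    rw [div_eq_iff hπ0, map_neg, map_sub, map_mul, map_one]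
    linear_combination -h3 + g * hS + algebraMap K F (c 0) * hge + algebraMap K F (c 0) * r * hxw
  rw [hkey]
  exact O.sub_mem (O.add_mem (O.mul_mem hc hgO) (O.mul_mem (O.algebraMap_mem _) (O.mul_mem hw hr)))
    (O.mul_mem (O.mul_mem huπ hgO) hδw)

/-- The residue of `dx / ∏_{a ∈ T} (x - a)` at a point whose first coordinate `α` lies in `T`. -/
theorem residue_eq_prod_inv [CharP K 2] [DecidableEq K] {f : Polynomial K} {x y : F}
    (hf : f.natDegree = 3) (hx : Transcendental K x)
    (hxy : y ^ 2 + y = Polynomial.aeval x f) (hF : IntermediateField.adjoin K {x, y} = ⊤)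
    {T : Finset K} {α β c : K} (hα : α ∈ T) (hP : β ^ 2 + β = f.eval α)
    (hres : HasResidue (localRingAt x y α β)
      ((∏ a ∈ T, (x - algebraMap K F a))⁻¹ • KaehlerDifferential.D K F x) c) :
    c = (∏ a ∈ T.erase α, (α - a))⁻¹ := by
  obtain ⟨δ, hδx, hδ⟩ := exists_derivation hf hx hxy hF
  let G : Polynomial K := ∏ a ∈ T.erase α, (Polynomial.X - Polynomial.C a)
  have hG : Polynomial.aeval x G = ∏ a ∈ T.erase α, (x - algebraMap K F a) := by
    simp [G, map_prod]
  have hGe : G.eval α = ∏ a ∈ T.erase α, (α - a) := by simp [G, Polynomial.eval_prod]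
  have hG0 : G ≠ 0 := Finset.prod_ne_zero_iff.mpr fun a _ => Polynomial.X_sub_C_ne_zero a
  have hmem : ∀ p : Polynomial K, Polynomial.aeval x p ∈ localRingAt x y α β := fun p => by
    have := aeval_mem_localRingAt (x := x) (y := y) α β
      (Polynomial.aeval (MvPolynomial.X 0) p)
    simpa [aeval_aeval_X_zero] using this
  rw [← Finset.mul_prod_erase T _ hα, ← hG] at hres
  rw [← hGe]
  refine residue_eq_inv hδx (fun z => derivation_mem_localRingAt hδ) ?_
    (inv_sub_notMem_localRingAt hf hx hxy hP) ?_ (hmem G) ?_ ?_ hres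
  · have := hmem (Polynomial.X - Polynomial.C α)
    rwa [map_sub, Polynomial.aeval_X, Polynomial.aeval_C] at this
  · exact fun h => hG0 (transcendental_iff.mp hx G h)
  · rw [hGe, Finset.prod_ne_zero_iff]
    intro a ha
    exact sub_ne_zero.mpr (Finset.ne_of_mem_erase ha).symm
  · obtain ⟨q, hq⟩ := Polynomial.X_sub_C_dvd_sub_C_eval (a := α) (p := G)
    refine ⟨_, hmem q, ?_⟩
    have := congrArg (Polynomial.aeval x) hq
    simp only [map_sub, map_mul, Polynomial.aeval_X, Polynomial.aeval_C] at this
    linear_combination this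

end Residue
end TECC

namespace TECC

/-! ### Pairs of conjugate points and the weighted power sums. -/

section PowerSums

open Polynomial

variable {K : Type*} [Field K] [DecidableEq K]

/-- The functional `p ↦ ∑_{a ∈ T} p(a) / ∏_{c ∈ T, c ≠ a} (a - c)`. -/
noncomputable def topCoeff (T : Finset K) : K[X] →ₗ[K] K :=
  ∑ a ∈ T, (∏ c ∈ T.erase a, (a - c))⁻¹ • leval a

theorem topCoeff_apply (T : Finset K) (p : K[X]) :
    topCoeff T p = ∑ a ∈ T, (∏ c ∈ T.erase a, (a - c))⁻¹ * p.eval a := by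
  simp [topCoeff, LinearMap.sum_apply]

/-- The functional is the leading-coefficient formula of Lagrange interpolation, which recovers `p`
itself in this degree range. -/
theorem topCoeff_eq_coeff {T : Finset K} {p : K[X]} (hp : p.degree < T.card) :
    topCoeff T p = p.coeff (T.card - 1) := by
  rw [Lagrange.coeff_eq_sum (s := T) (v := id) Function.injective_id.injOn hp, topCoeff_apply]
  exact Finset.sum_congr rfl fun a _ => by rw [id, div_eq_inv_mul]; rfl

theorem topCoeff_X_pow_of_lt {T : Finset K} {i : ℕ} (hi : i + 1 < T.card) :
    topCoeff T (X ^ i) = 0 := by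
  rw [topCoeff_eq_coeff (by rw [degree_X_pow]; exact_mod_cast (by omega)), coeff_X_pow,
    if_neg (by omega)]

theorem topCoeff_X_pow_card_sub_one {T : Finset K} (hT : 0 < T.card) :
    topCoeff T (X ^ (T.card - 1)) = 1 := by
  rw [topCoeff_eq_coeff (by rw [degree_X_pow]; exact_mod_cast (by omega)), coeff_X_pow,
    if_pos rfl]

variable {n : ℕ} {f : K[X]} {T : Finset K} {α β : Fin n → K}

/-- The points with first coordinate in `T` come in pairs `(a, b)`, `(a, b + 1)`. -/
theorem image_points_eq [CharP K 2]
    (hD : ∀ a b : K, (∃ m, α m = a ∧ β m = b) ↔ a ∈ T ∧ b ^ 2 + b = f.eval a)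
    {b : K → K} (hb : ∀ a ∈ T, b a ^ 2 + b a = f.eval a) :
    Finset.univ.image (fun m => (α m, β m)) =
      (T ×ˢ ({0, 1} : Finset K)).image fun p => (p.1, b p.1 + p.2) := by
  have h2 : (2 : K) = 0 := CharTwo.two_eq_zero
  ext ⟨a, c⟩
  simp only [Finset.mem_image, Finset.mem_univ, true_and, Prod.mk.injEq, hD, Finset.mem_product,
    Finset.mem_insert, Finset.mem_singleton, Prod.exists]
  constructor
  · rintro ⟨ha, hc⟩
    -- Squaring is additive in characteristic two, so the difference of two solutions of `b² + b =
    -- f(a)` is a root of `z² - z`.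
    have h : (c - b a) * (c - b a - 1) = 0 := by
      linear_combination hc - hb a ha - c * b a * h2 + (b a ^ 2 - c + b a) * h2
    rcases mul_eq_zero.mp h with h | h
    · exact ⟨a, 0, ⟨ha, Or.inl rfl⟩, rfl, by linear_combination -h⟩
    · exact ⟨a, 1, ⟨ha, Or.inr rfl⟩, rfl, by linear_combination -h⟩
  · rintro ⟨a, e, ⟨ha, he⟩, rfl, rfl⟩
    refine ⟨ha, ?_⟩
    rcases he with rfl | rfl
    · linear_combination hb a ha
    · linear_combination hb a ha + (b a + 1) * h2

theorem sum_points_eq [CharP K 2] (hinj : Function.Injective fun m => (α m, β m))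
    (hD : ∀ a b : K, (∃ m, α m = a ∧ β m = b) ↔ a ∈ T ∧ b ^ 2 + b = f.eval a)
    {b : K → K} (hb : ∀ a ∈ T, b a ^ 2 + b a = f.eval a)
    {M : Type*} [AddCommMonoid M] (g : K → K → M) :
    ∑ m, g (α m) (β m) = ∑ a ∈ T, (g a (b a) + g a (b a + 1)) := by
  have h1 : ∑ m, g (α m) (β m) =
      ∑ p ∈ Finset.univ.image (fun m => (α m, β m)), g p.1 p.2 :=
    (Finset.sum_image (f := fun p : K × K => g p.1 p.2) hinj.injOn).symm
  have hinj' : Function.Injective fun p : K × K => (p.1, b p.1 + p.2) := by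
    rintro ⟨a, c⟩ ⟨a', c'⟩ h
    simp only [Prod.mk.injEq] at h
    obtain ⟨rfl, h⟩ := h
    simpa using h
  rw [h1, image_points_eq hD hb, Finset.sum_image hinj'.injOn, Finset.sum_product]
  exact Finset.sum_congr rfl fun a _ => by rw [Finset.sum_pair zero_ne_one, add_zero]

variable {γ : Fin n → K}

/-- The weighted pairing of two functions `A + B y`, `C + D y` on the points. -/
theorem sum_weighted_mul_eq [CharP K 2] (hinj : Function.Injective fun m => (α m, β m))
    (hT : ∀ a ∈ T, ∃ b : K, b ^ 2 + b = f.eval a)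
    (hD : ∀ a b : K, (∃ m, α m = a ∧ β m = b) ↔ a ∈ T ∧ b ^ 2 + b = f.eval a)
    (hγ : ∀ m, γ m = (∏ c ∈ T.erase (α m), (α m - c))⁻¹) (A B C D : K[X]) :
    ∑ m, (A.eval (α m) + B.eval (α m) * β m) *
        (γ m * (C.eval (α m) + D.eval (α m) * β m)) =
      topCoeff T (A * D) + topCoeff T (B * (C + D)) := by
  choose! b hb using hT
  have h2 : (2 : K) = 0 := CharTwo.two_eq_zero
  simp_rw [hγ]
  rw [sum_points_eq hinj hD hb fun a c => (A.eval a + B.eval a * c) *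
    ((∏ c ∈ T.erase a, (a - c))⁻¹ * (C.eval a + D.eval a * c)), ← map_add, topCoeff_apply]
  refine Finset.sum_congr rfl fun a _ => ?_
  simp only [eval_add, eval_mul]
  generalize (∏ c ∈ T.erase a, (a - c))⁻¹ = w
  -- Over the pair, `AC` occurs twice, `AD + BC` with factor `2b + 1` and `BD` with factor `2b² + 2b
  -- + 1`; the multiples of two are discarded.
  linear_combination w * (eval a A * eval a C + (eval a A * eval a D + eval a B * eval a C) * b a +
    eval a B * eval a D * (b a ^ 2 + b a)) * h2

/-- This and the next two lemmas specialise the pairing. `M₁` and `M₂` agree because `y` and `y²`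
both sum to `1` over a conjugate pair. -/
theorem powerSum_one [CharP K 2] (hinj : Function.Injective fun m => (α m, β m))
    (hT : ∀ a ∈ T, ∃ b : K, b ^ 2 + b = f.eval a)
    (hD : ∀ a b : K, (∃ m, α m = a ∧ β m = b) ↔ a ∈ T ∧ b ^ 2 + b = f.eval a)
    (hγ : ∀ m, γ m = (∏ c ∈ T.erase (α m), (α m - c))⁻¹) (i : ℕ) :
    powerSum γ α β i 1 = topCoeff T (X ^ i) := by
  have := sum_weighted_mul_eq hinj hT hD hγ (X ^ i) 0 0 1
  rw [zero_mul, map_zero, add_zero, mul_one] at this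
  rw [← this, powerSum]
  exact Finset.sum_congr rfl fun m _ => by simp; ring

theorem powerSum_zero [CharP K 2] (hinj : Function.Injective fun m => (α m, β m))
    (hT : ∀ a ∈ T, ∃ b : K, b ^ 2 + b = f.eval a)
    (hD : ∀ a b : K, (∃ m, α m = a ∧ β m = b) ↔ a ∈ T ∧ b ^ 2 + b = f.eval a)
    (hγ : ∀ m, γ m = (∏ c ∈ T.erase (α m), (α m - c))⁻¹) (i : ℕ) :
    powerSum γ α β i 0 = 0 := by
  have := sum_weighted_mul_eq hinj hT hD hγ (X ^ i) 0 1 0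
  rw [mul_zero, zero_mul, map_zero, add_zero] at this
  rw [← this, powerSum]
  exact Finset.sum_congr rfl fun m _ => by simp; ring

theorem powerSum_two [CharP K 2] (hinj : Function.Injective fun m => (α m, β m))
    (hT : ∀ a ∈ T, ∃ b : K, b ^ 2 + b = f.eval a)
    (hD : ∀ a b : K, (∃ m, α m = a ∧ β m = b) ↔ a ∈ T ∧ b ^ 2 + b = f.eval a)
    (hγ : ∀ m, γ m = (∏ c ∈ T.erase (α m), (α m - c))⁻¹) (i : ℕ) :
    powerSum γ α β i 2 = topCoeff T (X ^ i) := by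
  have := sum_weighted_mul_eq hinj hT hD hγ 0 (X ^ i) 0 1
  rw [zero_mul, map_zero, zero_add, zero_add, mul_one] at this
  rw [← this, powerSum]
  exact Finset.sum_congr rfl fun m _ => by simp; ring

theorem card_points [CharP K 2] (hinj : Function.Injective fun m => (α m, β m))
    (hT : ∀ a ∈ T, ∃ b : K, b ^ 2 + b = f.eval a)
    (hD : ∀ a b : K, (∃ m, α m = a ∧ β m = b) ↔ a ∈ T ∧ b ^ 2 + b = f.eval a) :
    n = 2 * T.card := by
  choose! b hb using hT
  have := sum_points_eq hinj hD hb fun _ _ => 1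
  simpa [mul_comm] using this

end PowerSums

/-! ### Functions that vanish at all the points. -/

section Vanishing

open Polynomial

variable {K : Type*} [Field K] {n : ℕ} {f : K[X]} {T : Finset K} {α β : Fin n → K}

/-- A function `A + B y` with `A`, `B` of degree less than `|T|` that vanishes at all points is
zero. -/
theorem eval_eq_zero_of_forall_points [CharP K 2]
    (hT : ∀ a ∈ T, ∃ b : K, b ^ 2 + b = f.eval a)
    (hD : ∀ a b : K, (∃ m, α m = a ∧ β m = b) ↔ a ∈ T ∧ b ^ 2 + b = f.eval a)
    {A B : K[X]} (h : ∀ m, A.eval (α m) + B.eval (α m) * β m = 0) :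
    (A.degree < T.card → A = 0) ∧ (B.degree < T.card → B = 0) := by
  have h2 : (2 : K) = 0 := CharTwo.two_eq_zero
  have key : ∀ a ∈ T, A.eval a = 0 ∧ B.eval a = 0 := by
    intro a ha
    obtain ⟨b, hb⟩ := hT a ha
    obtain ⟨m, rfl, rfl⟩ := (hD a b).mpr ⟨ha, hb⟩
    -- The conjugate point also lies in `D`; subtracting the two equations leaves `B(a) = 0`.
    obtain ⟨m', h', hβ⟩ := (hD (α m) (β m + 1)).mpr ⟨ha, by linear_combination hb + (β m + 1) * h2⟩
    have e1 := h m
    have e2 := h m'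
    rw [h', hβ] at e2
    have hB : B.eval (α m) = 0 := by linear_combination e2 - e1
    exact ⟨by simpa [hB] using e1, hB⟩
  exact ⟨fun hd => eq_zero_of_degree_lt_of_eval_finset_eq_zero T hd fun a ha => (key a ha).1,
    fun hd => eq_zero_of_degree_lt_of_eval_finset_eq_zero T hd fun a ha => (key a ha).2⟩

end Vanishing
end TECC

namespace TECC

/-! ### Independence of the rows and orthogonality to the code. -/

section ParityCheck

open Polynomial

variable {K : Type*} [Field K] {n : ℕ}

/-- The independent codewords `G` bound the dimension of the dual by `n - |κ| = |ι|`. The rows of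
`H` already span that much, so the dimension of `C` itself is not needed. -/
theorem isParityCheckMatrix_of_card {ι κ : Type*} [Fintype ι] [Fintype κ]
    {H : Matrix ι (Fin n) K} {G : κ → Fin n → K} {C : Submodule K (Fin n → K)}
    (hH : LinearIndependent K fun i => H i) (hHC : ∀ i, H i ∈ dualCode C)
    (hG : LinearIndependent K G) (hGC : ∀ j, G j ∈ C)
    (hcard : Fintype.card ι + Fintype.card κ = n) : IsParityCheckMatrix H C := by
  refine ⟨hH, Submodule.eq_of_le_of_finrank_le ?_ ?_⟩
  · rw [Submodule.span_le]
    rintro _ ⟨i, rfl⟩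
    exact hHC i
  · have hle : dualCode C ≤ LinearMap.ker (Matrix.of G).mulVecLin := by
      intro v hv
      rw [LinearMap.mem_ker]
      ext j
      exact hv _ (hGC j)
    have h1 := Submodule.finrank_mono hle
    have h2 := LinearMap.finrank_range_add_finrank_ker (Matrix.of G).mulVecLin
    have h3 : (Matrix.of G).rank = Fintype.card κ := LinearIndependent.rank_matrix hG
    rw [Matrix.rank] at h3
    rw [Module.finrank_fin_fun] at h2
    rw [finrank_span_eq_card hH]
    omega

theorem natDegree_sum_C_mul_X_pow_le {N d : ℕ} {c : ℕ → K} {e : ℕ → ℕ}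
    (h : ∀ i < N, e i ≤ d) :
    (∑ i ∈ Finset.range N, C (c i) * X ^ e i : K[X]).natDegree ≤ d :=
  natDegree_sum_le_of_forall_le _ _ fun i hi =>
    (natDegree_C_mul_X_pow_le _ _).trans (h i (Finset.mem_range.mp hi))

/-- The polynomial with coefficients `c 0, …, c (p - 1)`. -/
noncomputable def finPoly {p : ℕ} (c : Fin p → K) : K[X] := ∑ i, C (c i) * X ^ (i : ℕ)

theorem coeff_finPoly {p : ℕ} (c : Fin p → K) (i : Fin p) : (finPoly c).coeff i = c i := by
  simp only [finPoly, finsetSum_coeff, coeff_C_mul_X_pow]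
  rw [Finset.sum_eq_single i (fun j _ hj => if_neg fun h => hj (Fin.ext h.symm)) (by simp),
    if_pos rfl]

theorem eq_zero_of_finPoly_eq_zero {p : ℕ} {c : Fin p → K} (h : finPoly c = 0) (i : Fin p) :
    c i = 0 := by
  rw [← coeff_finPoly c i, h, coeff_zero]

theorem degree_finPoly_lt {p : ℕ} (c : Fin p → K) : (finPoly c).degree < p := by
  refine (degree_sum_le _ _).trans_lt ((Finset.sup_lt_iff (WithBot.bot_lt_coe p)).mpr ?_)
  exact fun i _ => (degree_C_mul_X_pow_le _ _).trans_lt (WithBot.coe_lt_coe.mpr i.2)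

theorem eval_finPoly {p : ℕ} (c : Fin p → K) (a : K) :
    (finPoly c).eval a = ∑ i, c i * a ^ (i : ℕ) := by
  simp [finPoly, eval_finsetSum]

theorem coeff_finPoly_of_le {p : ℕ} (c : Fin p → K) {N : ℕ} (h : p ≤ N) :
    (finPoly c).coeff N = 0 :=
  coeff_eq_zero_of_degree_lt ((degree_finPoly_lt c).trans_le (by exact_mod_cast h))

variable {f : K[X]} {T : Finset K} {α β γ : Fin n → K}

/-- The extra function has a nonzero coefficient at an exponent `N` beyond those of the other rows.
The degree bound is asked only of the component carrying it: for even `k` and `ℓ = 0` the other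
component formally contains `x^s`. -/
theorem linearIndependent_extendedMatrix [CharP K 2]
    (hT : ∀ a ∈ T, ∃ b : K, b ^ 2 + b = f.eval a)
    (hD : ∀ a b : K, (∃ m, α m = a ∧ β m = b) ↔ a ∈ T ∧ b ^ 2 + b = f.eval a)
    (hγ : ∀ m, γ m ≠ 0) {g : MvPolynomial (Fin 2) K} {U V : K[X]}
    (hg : ∀ m, MvPolynomial.eval ![α m, β m] g = U.eval (α m) + V.eval (α m) * β m)
    {r N : ℕ} (hp : r / 2 + 1 ≤ T.card) (hq : (r - 1) / 2 ≤ T.card)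
    (hUV : (U.degree < T.card ∧ U.coeff N ≠ 0 ∧ r / 2 + 1 ≤ N) ∨
      (V.degree < T.card ∧ V.coeff N ≠ 0 ∧ (r - 1) / 2 ≤ N)) :
    LinearIndependent K fun i => extendedMatrix γ α β g r i := by
  rw [Fintype.linearIndependent_iff]
  intro c hc
  set c₀ := c (Sum.inl ())
  set u : Fin (r / 2 + 1) → K := fun i => c (Sum.inr (Sum.inl i))
  set v : Fin ((r - 1) / 2) → K := fun i => c (Sum.inr (Sum.inr i))
  have hpt : ∀ m, (C c₀ * U + finPoly u).eval (α m) +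
      (C c₀ * V + finPoly v).eval (α m) * β m = 0 := by
    intro m
    have h := congrFun hc m
    simp only [Fintype.sum_sum_type, Finset.univ_unique, Finset.sum_singleton,
      Finset.sum_apply, Pi.smul_apply, smul_eq_mul, extendedMatrix, gMatrix,
      Matrix.fromRows_apply_inl, Matrix.fromRows_apply_inr, Matrix.of_apply, hg, Pi.zero_apply] at h
    refine (mul_eq_zero.mp ?_).resolve_left (hγ m)
    rw [← h]
    simp only [eval_add, eval_mul, eval_C, eval_finPoly, mul_add, add_mul, Finset.mul_sum,
      Finset.sum_mul]
    have e1 : ∀ i : Fin (r / 2 + 1), γ m * (u i * α m ^ (i : ℕ)) =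
        c (Sum.inr (Sum.inl i)) * (γ m * α m ^ (i : ℕ)) := fun i => by simp only [u]; ring
    have e2 : ∀ i : Fin ((r - 1) / 2), γ m * (v i * α m ^ (i : ℕ) * β m) =
        c (Sum.inr (Sum.inr i)) * (γ m * α m ^ (i : ℕ) * β m) := fun i => by simp only [v]; ring
    rw [Finset.sum_congr rfl fun i _ => e1 i, Finset.sum_congr rfl fun i _ => e2 i]
    simp only [c₀, PUnit.default_eq_unit]
    ring
  obtain ⟨hA, hB⟩ := eval_eq_zero_of_forall_points hT hD hpt
  have hu : (finPoly u).degree < T.card :=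
    (degree_finPoly_lt u).trans_le (by exact_mod_cast hp)
  have hv : (finPoly v).degree < T.card :=
    (degree_finPoly_lt v).trans_le (by exact_mod_cast hq)
  have hc₀ : c₀ = 0 := by
    have aux : ∀ {W S : K[X]} (_ : S.degree < T.card) (_ : S.coeff N = 0)
        (_ : (C c₀ * W + S).degree < T.card → C c₀ * W + S = 0)
        (_ : W.degree < T.card) (_ : W.coeff N ≠ 0), c₀ = 0 := by
      intro W S hS hSN h hW hWN
      have hle : (C c₀ * W).degree ≤ W.degree := by
        rw [← smul_eq_C_mul]; exact degree_smul_le _ _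
      have h0 := congrArg (fun P => coeff P N)
        (h ((degree_add_le _ _).trans_lt (max_lt (hle.trans_lt hW) hS)))
      simp only [coeff_add, coeff_C_mul, hSN, add_zero, coeff_zero] at h0
      exact (mul_eq_zero.mp h0).resolve_right hWN
    rcases hUV with ⟨h1, h2, h3⟩ | ⟨h1, h2, h3⟩
    · exact aux hu (coeff_finPoly_of_le u h3) hA h1 h2
    · exact aux hv (coeff_finPoly_of_le v h3) hB h1 h2
  rw [hc₀, C_0, zero_mul, zero_add] at hA hB
  rintro (⟨⟩ | i | j)
  · exact hc₀
  · exact eq_zero_of_finPoly_eq_zero (hA hu) i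
  · exact eq_zero_of_finPoly_eq_zero (hB hv) j

/-- Rows of a generator matrix of the twisted code of odd dimension. -/
def oddRow (α β : Fin n → K) (ℓ w : ℕ) (η : K) (p q : ℕ) : Fin p ⊕ Fin q → Fin n → K :=
  Sum.elim (fun i m => α m ^ (i : ℕ))
    (fun j m => α m ^ (j : ℕ) * β m + if (j : ℕ) = ℓ then η * α m ^ w else 0)

/-- Rows of a generator matrix of the twisted code of even dimension. -/
def evenRow (α β : Fin n → K) (ℓ w : ℕ) (η : K) (p q : ℕ) : Fin p ⊕ Fin q → Fin n → K :=
  Sum.elim (fun i m => α m ^ (i : ℕ) + if (i : ℕ) = ℓ then η * α m ^ w * β m else 0)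
    (fun j m => α m ^ (j : ℕ) * β m)

/-- The twist lies in the `1`-component but carries a coefficient of the `y`-component. That
component vanishes first and takes the twist with it, so no bound on `w` is needed. -/
theorem linearIndependent_oddRow [CharP K 2]
    (hT : ∀ a ∈ T, ∃ b : K, b ^ 2 + b = f.eval a)
    (hD : ∀ a b : K, (∃ m, α m = a ∧ β m = b) ↔ a ∈ T ∧ b ^ 2 + b = f.eval a)
    (ℓ w : ℕ) (η : K) {p q : ℕ} (hp : p ≤ T.card) (hq : q ≤ T.card) :
    LinearIndependent K (oddRow α β ℓ w η p q) := by
  rw [Fintype.linearIndependent_iff]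
  intro c hc
  set u : Fin p → K := fun i => c (Sum.inl i)
  set v : Fin q → K := fun i => c (Sum.inr i)
  have hpt : ∀ m, (finPoly u + ∑ j : Fin q, if (j : ℕ) = ℓ then C (v j * η) * X ^ w else 0).eval
      (α m) + (finPoly v).eval (α m) * β m = 0 := by
    intro m
    have h := congrFun hc m
    simp only [Fintype.sum_sum_type, Finset.sum_apply, Pi.smul_apply, smul_eq_mul,
      oddRow, Sum.elim_inl, Sum.elim_inr, Pi.zero_apply, mul_add, Finset.sum_add_distrib] at h
    rw [← h]
    simp only [eval_add, eval_finPoly, Finset.sum_mul, eval_finsetSum, apply_ite (eval (α m)),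
      eval_mul, eval_C, eval_pow, eval_X, eval_zero, mul_ite, mul_zero, mul_assoc, u, v]
    ring
  obtain ⟨hA, hB⟩ := eval_eq_zero_of_forall_points hT hD hpt
  have hv : ∀ j, v j = 0 := eq_zero_of_finPoly_eq_zero
    (hB ((degree_finPoly_lt v).trans_le (by exact_mod_cast hq)))
  simp only [hv, zero_mul, C_0, ite_self, Finset.sum_const_zero, add_zero] at hA
  have hu : ∀ j, u j = 0 := eq_zero_of_finPoly_eq_zero
    (hA ((degree_finPoly_lt u).trans_le (by exact_mod_cast hp)))
  rintro (i | j)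
  exacts [hu i, hv j]

theorem linearIndependent_evenRow [CharP K 2]
    (hT : ∀ a ∈ T, ∃ b : K, b ^ 2 + b = f.eval a)
    (hD : ∀ a b : K, (∃ m, α m = a ∧ β m = b) ↔ a ∈ T ∧ b ^ 2 + b = f.eval a)
    (ℓ w : ℕ) (η : K) {p q : ℕ} (hp : p ≤ T.card) (hq : q ≤ T.card) :
    LinearIndependent K (evenRow α β ℓ w η p q) := by
  rw [Fintype.linearIndependent_iff]
  intro c hc
  set u : Fin p → K := fun i => c (Sum.inl i)
  set v : Fin q → K := fun i => c (Sum.inr i)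
  have hpt : ∀ m, (finPoly u).eval (α m) +
      (finPoly v + ∑ j : Fin p, if (j : ℕ) = ℓ then C (u j * η) * X ^ w else 0).eval (α m) * β m
        = 0 := by
    intro m
    have h := congrFun hc m
    simp only [Fintype.sum_sum_type, Finset.sum_apply, Pi.smul_apply, smul_eq_mul,
      evenRow, Sum.elim_inl, Sum.elim_inr, Pi.zero_apply, mul_add, Finset.sum_add_distrib] at h
    rw [← h]
    simp only [eval_add, eval_finPoly, add_mul, Finset.sum_mul, eval_finsetSum,
      apply_ite (eval (α m)), eval_mul, eval_C, eval_pow, eval_X, eval_zero, mul_ite, ite_mul,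
      zero_mul, mul_zero, mul_assoc, u, v]
    ring
  obtain ⟨hA, hB⟩ := eval_eq_zero_of_forall_points hT hD hpt
  have hu : ∀ j, u j = 0 := eq_zero_of_finPoly_eq_zero
    (hA ((degree_finPoly_lt u).trans_le (by exact_mod_cast hp)))
  simp only [hu, zero_mul, C_0, ite_self, Finset.sum_const_zero, add_zero] at hB
  have hv : ∀ j, v j = 0 := eq_zero_of_finPoly_eq_zero
    (hB ((degree_finPoly_lt v).trans_le (by exact_mod_cast hq)))
  rintro (i | j)
  exacts [hu i, hv j]

theorem evalMap_apply (g : MvPolynomial (Fin 2) K) (m : Fin n) :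
    evalMap α β g m = MvPolynomial.aeval ![α m, β m] g := rfl

theorem evalMap_xyPoly (p r : ℕ) (a b : ℕ → K) (m : Fin n) :
    evalMap α β (xyPoly p r a b) m = (∑ i ∈ Finset.range p, C (a i) * X ^ i : K[X]).eval (α m) +
      (∑ j ∈ Finset.range r, C (b j) * X ^ j : K[X]).eval (α m) * β m := by
  simp [evalMap_apply, xyPoly, eval_finsetSum, Finset.sum_mul]

theorem sum_single_mul_X_pow {p i : ℕ} (hi : i < p) :
    ∑ j ∈ Finset.range p, C ((Pi.single i 1 : ℕ → K) j) * X ^ j = (X ^ i : K[X]) := by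
  rw [Finset.sum_eq_single i (fun j _ hj => by simp [hj])
    (fun h => absurd (Finset.mem_range.mpr hi) h)]
  simp

theorem oddRow_mem (k ℓ : ℕ) (η : K) (i) :
    oddRow α β ℓ ((k + 1) / 2) η ((k - 1) / 2 + 1) ((k - 3) / 2 + 1) i ∈ oddCode α β k ℓ η := by
  rcases i with i | j
  · refine ⟨_, ⟨Pi.single i 1, 0, rfl⟩, ?_⟩
    ext m
    rw [map_add, Pi.add_apply, evalMap_xyPoly, sum_single_mul_X_pow i.2, evalMap_apply]
    simp [oddRow]
  · refine ⟨_, ⟨0, Pi.single j 1, rfl⟩, ?_⟩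
    ext m
    rw [map_add, Pi.add_apply, evalMap_xyPoly, sum_single_mul_X_pow j.2, evalMap_apply]
    simp [oddRow, Pi.single_apply, eq_comm]

theorem evenRow_mem (k ℓ : ℕ) (η : K) (i) :
    evenRow α β ℓ ((k - 2) / 2) η (k / 2 + 1) ((k - 4) / 2 + 1) i ∈ evenCode α β k ℓ η := by
  rcases i with i | j
  · refine ⟨_, ⟨Pi.single i 1, 0, rfl⟩, ?_⟩
    ext m
    rw [map_add, Pi.add_apply, evalMap_xyPoly, sum_single_mul_X_pow i.2, evalMap_apply]
    simp [evenRow, Pi.single_apply, eq_comm, mul_assoc]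
  · refine ⟨_, ⟨0, Pi.single j 1, rfl⟩, ?_⟩
    ext m
    rw [map_add, Pi.add_apply, evalMap_xyPoly, sum_single_mul_X_pow j.2, evalMap_apply]
    simp [evenRow]

variable [DecidableEq K]

theorem topCoeff_C_mul (c : K) (P : K[X]) : topCoeff T (C c * P) = c * topCoeff T P := by
  rw [← smul_eq_C_mul, map_smul, smul_eq_mul]

theorem topCoeff_sum_mul (N : ℕ) (a : ℕ → K) (P : K[X]) :
    topCoeff T ((∑ i ∈ Finset.range N, C (a i) * X ^ i) * P) =
      ∑ i ∈ Finset.range N, a i * topCoeff T (X ^ i * P) := by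
  simp [Finset.sum_mul, ← smul_eq_C_mul]

theorem topCoeff_X_pow_mul_sum (N p : ℕ) (c : ℕ → K) (e : ℕ → ℕ) :
    topCoeff T (X ^ p * ∑ i ∈ Finset.range N, C (c i) * X ^ e i) =
      ∑ i ∈ Finset.range N, c i * topCoeff T (X ^ (p + e i)) := by
  simp [Finset.mul_sum, ← smul_eq_C_mul, pow_add]

/-- It suffices to test against a basis of the code. Against `U + V y`, the function `x^i` pairs to
`L(X^i V)` and `x^j y` to `L(X^j (U + V))`, with `L = topCoeff T`. The hypotheses are these
equations, `h3` being the one for the twisted element. -/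
theorem mem_dualCode_oddCode [CharP K 2] (hinj : Function.Injective fun m => (α m, β m))
    (hT : ∀ a ∈ T, ∃ b : K, b ^ 2 + b = f.eval a)
    (hD : ∀ a b : K, (∃ m, α m = a ∧ β m = b) ↔ a ∈ T ∧ b ^ 2 + b = f.eval a)
    (hγ : ∀ m, γ m = (∏ c ∈ T.erase (α m), (α m - c))⁻¹) {k ℓ : ℕ} {η : K} {U V : K[X]}
    (hℓ : ℓ ≤ (k - 3) / 2) (h1 : ∀ i ≤ (k - 1) / 2, topCoeff T (X ^ i * V) = 0)
    (h2 : ∀ j ≤ (k - 3) / 2, j ≠ ℓ → topCoeff T (X ^ j * (U + V)) = 0)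
    (h3 : topCoeff T (X ^ ℓ * (U + V)) + η * topCoeff T (X ^ ((k + 1) / 2) * V) = 0) :
    (fun m => γ m * (U.eval (α m) + V.eval (α m) * β m)) ∈ dualCode (oddCode α β k ℓ η) := by
  rintro _ ⟨_, ⟨a, b, rfl⟩, rfl⟩
  have key := sum_weighted_mul_eq hinj hT hD hγ
    ((∑ i ∈ Finset.range ((k - 1) / 2 + 1), C (a i) * X ^ i) + C (b ℓ * η) * X ^ ((k + 1) / 2))
    (∑ j ∈ Finset.range ((k - 3) / 2 + 1), C (b j) * X ^ j) U V
  have e1 : ∑ i ∈ Finset.range ((k - 1) / 2 + 1), a i * topCoeff T (X ^ i * V) = 0 :=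
    Finset.sum_eq_zero fun i hi => by rw [h1 i (Finset.mem_range_succ_iff.mp hi), mul_zero]
  have e2 : ∑ j ∈ Finset.range ((k - 3) / 2 + 1), b j * topCoeff T (X ^ j * (U + V)) =
      b ℓ * topCoeff T (X ^ ℓ * (U + V)) :=
    Finset.sum_eq_single ℓ
      (fun j hj hne => by rw [h2 j (Finset.mem_range_succ_iff.mp hj) hne, mul_zero])
      (fun h => absurd (Finset.mem_range_succ_iff.mpr hℓ) h)
  rw [add_mul, map_add, topCoeff_sum_mul, topCoeff_sum_mul, e1, e2, mul_assoc (C _), topCoeff_C_mul] at key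
  calc _ = _ := Finset.sum_congr rfl fun m _ => ?_
    _ = _ := key
    _ = 0 := by linear_combination b ℓ * h3
  rw [map_add, Pi.add_apply, evalMap_xyPoly, evalMap_apply]
  simp only [map_mul, map_pow, MvPolynomial.aeval_X, MvPolynomial.aeval_C, eval_add, eval_mul,
    eval_C, eval_pow, eval_X, Algebra.algebraMap_self, RingHom.id_apply, Matrix.cons_val_zero]
  ring

theorem mem_dualCode_evenCode [CharP K 2] (hinj : Function.Injective fun m => (α m, β m))
    (hT : ∀ a ∈ T, ∃ b : K, b ^ 2 + b = f.eval a)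
    (hD : ∀ a b : K, (∃ m, α m = a ∧ β m = b) ↔ a ∈ T ∧ b ^ 2 + b = f.eval a)
    (hγ : ∀ m, γ m = (∏ c ∈ T.erase (α m), (α m - c))⁻¹) {k ℓ : ℕ} {η : K} {U V : K[X]}
    (hℓ : ℓ ≤ k / 2) (h1 : ∀ j ≤ (k - 4) / 2, topCoeff T (X ^ j * (U + V)) = 0)
    (h2 : ∀ i ≤ k / 2, i ≠ ℓ → topCoeff T (X ^ i * V) = 0)
    (h3 : topCoeff T (X ^ ℓ * V) + η * topCoeff T (X ^ ((k - 2) / 2) * (U + V)) = 0) :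
    (fun m => γ m * (U.eval (α m) + V.eval (α m) * β m)) ∈ dualCode (evenCode α β k ℓ η) := by
  rintro _ ⟨_, ⟨a, b, rfl⟩, rfl⟩
  have key := sum_weighted_mul_eq hinj hT hD hγ
    (∑ i ∈ Finset.range (k / 2 + 1), C (a i) * X ^ i)
    ((∑ j ∈ Finset.range ((k - 4) / 2 + 1), C (b j) * X ^ j) + C (a ℓ * η) * X ^ ((k - 2) / 2)) U V
  have e1 : ∑ j ∈ Finset.range ((k - 4) / 2 + 1), b j * topCoeff T (X ^ j * (U + V)) = 0 :=
    Finset.sum_eq_zero fun i hi => by rw [h1 i (Finset.mem_range_succ_iff.mp hi), mul_zero]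
  have e2 : ∑ i ∈ Finset.range (k / 2 + 1), a i * topCoeff T (X ^ i * V) =
      a ℓ * topCoeff T (X ^ ℓ * V) :=
    Finset.sum_eq_single ℓ
      (fun j hj hne => by rw [h2 j (Finset.mem_range_succ_iff.mp hj) hne, mul_zero])
      (fun h => absurd (Finset.mem_range_succ_iff.mpr hℓ) h)
  rw [add_mul (∑ j ∈ Finset.range ((k - 4) / 2 + 1), C (b j) * X ^ j), map_add, topCoeff_sum_mul,
    topCoeff_sum_mul, e1, e2,
    mul_assoc (C _), topCoeff_C_mul] at key
  calc _ = _ := Finset.sum_congr rfl fun m _ => ?_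
    _ = _ := key
    _ = 0 := by linear_combination a ℓ * h3
  rw [map_add, Pi.add_apply, evalMap_xyPoly, evalMap_apply]
  simp only [map_mul, map_pow, MvPolynomial.aeval_X, MvPolynomial.aeval_C, eval_add, eval_mul,
    eval_C, eval_pow, eval_X, Algebra.algebraMap_self, RingHom.id_apply, Matrix.cons_val_zero,
    Matrix.cons_val_one]
  ring

end ParityCheck
end TECC

namespace TECC

/-! ### The recursions as a triangular linear system. -/

section Recursions

variable {K : Type*} [Field K] {L : ℕ → K} {s ℓ R : ℕ}

theorem sum_range_eq_of_vanishing (hL : ∀ i, i + 1 < s → L i = 0) {c : ℕ → K} {e : ℕ → ℕ}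
    {N : ℕ} (r : ℕ) (hr : r ≤ N) (h : ∀ j, r ≤ j → j < N → e j + 1 < s) :
    ∑ j ∈ Finset.range N, c j * L (e j) = ∑ j ∈ Finset.range r, c j * L (e j) := by
  refine (Finset.sum_subset (Finset.range_subset_range.mpr hr) fun j hj hj' => ?_).symm
  rw [Finset.mem_range] at hj hj'
  rw [hL _ (h j (by omega) hj), mul_zero]

theorem sum_range_congr_index {c : ℕ → K} {e e' : ℕ → ℕ} {N : ℕ} (h : ∀ j < N, e j = e' j) :
    ∑ j ∈ Finset.range N, c j * L (e j) = ∑ j ∈ Finset.range N, c j * L (e' j) :=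
  Finset.sum_congr rfl fun j hj => by rw [h j (Finset.mem_range.mp hj)]

/-- Reduction of a convolution whose top term is `L (s - 1) = 1`. -/
theorem sum_range_eq_add_top (hL : ∀ i, i + 1 < s → L i = 0) (hL1 : L (s - 1) = 1) {c : ℕ → K}
    {e e' : ℕ → ℕ} {N : ℕ} (r : ℕ) (hr : r < N) (h : ∀ j, r < j → j < N → e j + 1 < s)
    (htop : e r = s - 1) (he : ∀ j < r, e j = e' j) :
    ∑ j ∈ Finset.range N, c j * L (e j) = ∑ j ∈ Finset.range r, c j * L (e' j) + c r := by
  rw [sum_range_eq_of_vanishing hL (r + 1) hr (fun j hj => h j hj), Finset.sum_range_succ, htop,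
    hL1, mul_one, sum_range_congr_index he]

theorem sum_range_eq_zero (hL : ∀ i, i + 1 < s → L i = 0) {c : ℕ → K} {e : ℕ → ℕ}
    {N : ℕ} (h : ∀ j < N, e j + 1 < s) : ∑ j ∈ Finset.range N, c j * L (e j) = 0 := by
  rw [sum_range_eq_of_vanishing hL 0 (Nat.zero_le _) fun j _ => h j, Finset.sum_range_zero]

/-- For `p ≤ ℓ + 1` every exponent is below `s - 1`. For `p = ℓ + r + 2` the last surviving term is
`b r`, and the recursion is this equation solved for it. This uses `b 0, …, b (R - 1)` and leaves `b
R` free for the twist. -/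
theorem odd_sum_b_eq_zero (hL : ∀ i, i + 1 < s → L i = 0) (hL1 : L (s - 1) = 1)
    (hs : ℓ + R + 3 ≤ s) {b : ℕ → K}
    (hb : ∀ r ∈ Finset.Icc 1 R, b (r - 1) = -∑ j ∈ Finset.range (r - 1), b j * L (s + r - 2 - j))
    {p : ℕ} (hp : p ≤ ℓ + R + 1) :
    ∑ j ∈ Finset.range (R + 1), b j * L (p + (s - ℓ - 3 - j)) = 0 := by
  rcases le_or_gt p (ℓ + 1) with h | h
  · exact sum_range_eq_zero hL fun j hj => by omega
  · obtain ⟨r, rfl⟩ := Nat.exists_eq_add_of_lt h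
    have hbr := hb (r + 1) (Finset.mem_Icc.mpr (by omega))
    rw [Nat.add_sub_cancel] at hbr
    rw [sum_range_eq_add_top hL hL1 (e' := fun j => s + (r + 1) - 2 - j) r (by omega)
      (fun j _ _ => by omega) (by omega) (fun j _ => by omega), hbr, add_neg_cancel]

/-- For `p = ℓ + r` with `r ≥ 1` the equation determines `a r`. At `p = ℓ` the sum would be `a 0 =
1`, which only the twist can cancel. -/
theorem odd_sum_a_add_sum_b_eq_zero (hL : ∀ i, i + 1 < s → L i = 0) (hL1 : L (s - 1) = 1)
    (hs : ℓ + R + 3 ≤ s) {a b : ℕ → K}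
    (ha : ∀ r ∈ Finset.Icc 1 R, a r = -(∑ i ∈ Finset.range r, a i * L (s + r - 1 - i) +
      ∑ j ∈ Finset.range (r - 1), b j * L (s + r - 3 - j)))
    {p : ℕ} (hp : p ≤ ℓ + R) (hpℓ : p ≠ ℓ) :
    ∑ i ∈ Finset.range (R + 1), a i * L (p + (s - ℓ - 1 - i)) +
      ∑ j ∈ Finset.range (R + 1), b j * L (p + (s - ℓ - 3 - j)) = 0 := by
  rcases lt_or_gt_of_ne hpℓ with h | h
  · rw [sum_range_eq_zero hL fun j hj => by omega, sum_range_eq_zero hL fun j hj => by omega,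
      add_zero]
  · obtain ⟨r, rfl⟩ := Nat.exists_eq_add_of_lt h
    have har := ha (r + 1) (Finset.mem_Icc.mpr (by omega))
    rw [Nat.add_sub_cancel] at har
    rw [sum_range_eq_of_vanishing hL (c := b) r (by omega) (fun j _ _ => by omega),
      sum_range_congr_index (c := b) (e' := fun j => s + (r + 1) - 3 - j) (fun j _ => by omega),
      sum_range_eq_add_top hL hL1 (c := a) (e' := fun j => s + (r + 1) - 1 - j) (r + 1) (by omega)
      (fun j _ _ => by omega) (by omega) (fun j _ => by omega), har]
    ring

theorem even_sum_h_eq_zero (hL : ∀ i, i + 1 < s → L i = 0) (hL1 : L (s - 1) = 1)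
    (hs : ℓ + R + 1 ≤ s) {h : ℕ → K}
    (hh : ∀ r ∈ Finset.Icc 1 R, h r = -∑ j ∈ Finset.range r, h j * L (s + r - 1 - j))
    {p : ℕ} (hp : p ≤ ℓ + R) (hpℓ : p ≠ ℓ) :
    ∑ j ∈ Finset.range (R + 1), h j * L (p + (s - ℓ - 1 - j)) = 0 := by
  rcases lt_or_gt_of_ne hpℓ with h | h
  · exact sum_range_eq_zero hL fun j hj => by omega
  · obtain ⟨r, rfl⟩ := Nat.exists_eq_add_of_lt h
    have hhr := hh (r + 1) (Finset.mem_Icc.mpr (by omega))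
    rw [sum_range_eq_add_top hL hL1 (e' := fun j => s + (r + 1) - 1 - j) (r + 1) (by omega)
      (fun j _ _ => by omega) (by omega) (fun j _ => by omega), hhr, add_neg_cancel]

/-- For `p = ℓ + r - 1` the term in `e r` has exponent `s - 1`, and the recursion solves for it. The
bound on `p` leaves `e R` free for the twist. -/
theorem even_sum_e_add_sum_h_eq_zero (hL : ∀ i, i + 1 < s → L i = 0) (hL1 : L (s - 1) = 1)
    (hs : ℓ + R + 1 ≤ s) {e h : ℕ → K}
    (he : ∀ r ∈ Finset.Icc 1 R,
      e (r - 1) = -(∑ i ∈ Finset.range (r - 1), e i * L (s + r - 2 - i) +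
        ∑ j ∈ Finset.range (r - 1), h j * L (s + r - 3 - j)))
    {p : ℕ} (hp : p + 2 ≤ ℓ + R) :
    ∑ i ∈ Finset.range (R + 1), e i * L (p + (s - ℓ - i)) +
      ∑ j ∈ Finset.range (R + 1), h j * L (p + (s - ℓ - 1 - j)) = 0 := by
  rcases le_or_gt (p + 2) ℓ with hlt | hlt
  · rw [sum_range_eq_zero hL fun j hj => by omega, sum_range_eq_zero hL fun j hj => by omega,
      add_zero]
  · obtain ⟨r, hr⟩ := Nat.exists_eq_add_of_lt hlt
    have her := he (r + 1) (Finset.mem_Icc.mpr (by omega))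
    rw [Nat.add_sub_cancel] at her
    rw [sum_range_eq_of_vanishing hL (c := h) r (by omega) (fun j _ _ => by omega),
      sum_range_congr_index (c := h) (e' := fun j => s + (r + 1) - 3 - j) (fun j _ => by omega),
      sum_range_eq_add_top hL hL1 (c := e) (e' := fun j => s + (r + 1) - 2 - j) r (by omega)
      (fun j _ _ => by omega) (by omega) (fun j _ => by omega), her]
    ring

end Recursions

/-! ### Assembly of the two parity-check matrices. -/

section Main

open Polynomial

variable {K : Type*} [Field K] {n : ℕ} {f : K[X]} {T : Finset K} {α β γ : Fin n → K}

theorem extendedMatrix_mem {C : Submodule K (Fin n → K)} {g : MvPolynomial (Fin 2) K} {r : ℕ}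
    {U V : K[X]}
    (hg : ∀ m, MvPolynomial.eval ![α m, β m] g = U.eval (α m) + V.eval (α m) * β m)
    (h : (fun m => γ m * (U.eval (α m) + V.eval (α m) * β m)) ∈ dualCode C)
    (h₁ : ∀ i < r / 2 + 1, (fun m => γ m * ((X ^ i : K[X]).eval (α m) +
      (0 : K[X]).eval (α m) * β m)) ∈ dualCode C)
    (h₂ : ∀ j < (r - 1) / 2, (fun m => γ m * ((0 : K[X]).eval (α m) +
      (X ^ j : K[X]).eval (α m) * β m)) ∈ dualCode C) (i) :
    extendedMatrix γ α β g r i ∈ dualCode C := by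
  rcases i with ⟨⟩ | i | j
  · convert h using 2 with m
    rw [← hg m]; rfl
  · convert h₁ i i.2 using 2 with m
    simp [extendedMatrix, gMatrix]
  · convert h₂ j j.2 using 2 with m
    simp [extendedMatrix, gMatrix, mul_assoc]

theorem degree_sum_lt {N d : ℕ} {c : ℕ → K} {e : ℕ → ℕ} (h : ∀ i < N, e i < d) (hd : 0 < d) :
    (∑ i ∈ Finset.range N, C (c i) * X ^ e i : K[X]).degree < d := by
  have : (∑ i ∈ Finset.range N, C (c i) * X ^ e i : K[X]).natDegree ≤ d - 1 :=
    natDegree_sum_C_mul_X_pow_le fun i hi => by have := h i hi; omega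
  exact degree_le_natDegree.trans_lt (by exact_mod_cast (by omega))

theorem coeff_sum_top {N d : ℕ} {c : ℕ → K} (hN : 0 < N) (hd : ∀ j < N, j ≤ d) :
    (∑ j ∈ Finset.range N, C (c j) * X ^ (d - j) : K[X]).coeff d = c 0 := by
  simp only [finsetSum_coeff, coeff_C_mul_X_pow]
  rw [Finset.sum_eq_single 0 (fun j hj hj0 => if_neg ?_)
    (fun h => absurd (Finset.mem_range.mpr hN) h), if_pos (by simp)]
  have := hd j (Finset.mem_range.mp hj)
  omega

variable [DecidableEq K]

theorem topCoeff_X_pow_mul_X_pow {i j : ℕ} (h : i + j + 1 < T.card) :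
    topCoeff T (X ^ i * X ^ j) = 0 := by
  rw [← pow_add, topCoeff_X_pow_of_lt h]

variable [CharP K 2]

theorem isParityCheckMatrix_odd (hinj : Function.Injective fun m => (α m, β m))
    (hT : ∀ a ∈ T, ∃ b : K, b ^ 2 + b = f.eval a)
    (hD : ∀ a b : K, (∃ m, α m = a ∧ β m = b) ↔ a ∈ T ∧ b ^ 2 + b = f.eval a)
    (hγ : ∀ m, γ m = (∏ c ∈ T.erase (α m), (α m - c))⁻¹) (hγ0 : ∀ m, γ m ≠ 0)
    {k ℓ : ℕ} {η : K} (hk : 3 ≤ k) (hodd : Odd k) (hkn : k + 2 ≤ n) (hη : η ≠ 0)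
    (hℓ : ℓ ≤ (k - 3) / 2) {a b : ℕ → K} (h : OddRecursion γ α β T.card k ℓ η a b) :
    IsParityCheckMatrix (extendedMatrix γ α β (oddPoly T.card k ℓ a b) (n - k - 1))
      (oddCode α β k ℓ η) := by
  have hn := card_points hinj hT hD
  have hL : ∀ i, i + 1 < T.card → topCoeff T (X ^ i) = 0 := fun i => topCoeff_X_pow_of_lt
  have hL1 : topCoeff T (X ^ (T.card - 1)) = 1 := topCoeff_X_pow_card_sub_one (by omega)
  obtain ⟨κ, rfl⟩ : ∃ κ, k = 2 * κ + 3 := by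
    obtain ⟨t, rfl⟩ := hodd; exact ⟨t - 1, by omega⟩
  obtain ⟨R, rfl⟩ : ∃ R, κ = ℓ + R := ⟨κ - ℓ, by omega⟩
  have hR : (2 * (ℓ + R) + 3 - 3) / 2 - ℓ = R := by omega
  have hk2 : (2 * (ℓ + R) + 3 + 1) / 2 = ℓ + R + 2 := by omega
  simp only [OddRecursion, powerSum_one hinj hT hD hγ, powerSum_two hinj hT hD hγ,
    powerSum_zero hinj hT hD hγ, hL1, div_one, mul_one, hR, hk2, mul_zero, Finset.sum_const_zero,
    add_zero] at h
  obtain ⟨ha0, ha, hb, hbR⟩ := h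
  set U : K[X] := ∑ i ∈ Finset.range (R + 1), C (a i) * X ^ (T.card - ℓ - 1 - i) with hU
  set V : K[X] := ∑ j ∈ Finset.range (R + 1), C (b j) * X ^ (T.card - ℓ - 3 - j) with hV
  have hg : ∀ m, MvPolynomial.eval ![α m, β m] (oddPoly T.card (2 * (ℓ + R) + 3) ℓ a b) =
      U.eval (α m) + V.eval (α m) * β m := fun m => by
    simp [oddPoly, hU, hV, eval_finsetSum, Finset.sum_mul]
  refine isParityCheckMatrix_of_card
    (linearIndependent_extendedMatrix hT hD hγ0 hg (N := T.card - ℓ - 1) (by omega) (by omega)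
      (Or.inl ⟨degree_sum_lt (fun i _ => by omega) (by omega), ?_, by omega⟩))
    (extendedMatrix_mem hg ?_ (fun i hi => ?_) fun j hj => ?_)
    (linearIndependent_oddRow hT hD ℓ ((2 * (ℓ + R) + 3 + 1) / 2) η
      (p := (2 * (ℓ + R) + 3 - 1) / 2 + 1) (q := (2 * (ℓ + R) + 3 - 3) / 2 + 1)
      (by omega) (by omega))
    (oddRow_mem _ _ _) (by simp only [Fintype.card_sum, Fintype.card_fin, Fintype.card_unit]; omega)
  · rw [hU, coeff_sum_top (by omega) (fun j _ => by omega), ha0]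
    exact one_ne_zero
  · refine mem_dualCode_oddCode hinj hT hD hγ hℓ (fun i hi => ?_) (fun j hj hne => ?_) ?_
    · rw [hV, topCoeff_X_pow_mul_sum]
      exact odd_sum_b_eq_zero (L := fun i => topCoeff T (X ^ i)) hL hL1 (by omega) hb (by omega)
    · rw [hU, hV, mul_add, map_add, topCoeff_X_pow_mul_sum, topCoeff_X_pow_mul_sum]
      exact odd_sum_a_add_sum_b_eq_zero (L := fun i => topCoeff T (X ^ i)) hL hL1 (by omega) ha
        (by omega) hne
    · rw [hk2, hU, hV, mul_add, map_add, topCoeff_X_pow_mul_sum, topCoeff_X_pow_mul_sum,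
        topCoeff_X_pow_mul_sum,
        -- The untwisted part reduces to `a 0 = 1`, so `e'` is a dummy over an empty range. The
        -- twist contributes `η` times a sum whose last term is `b R`, chosen to cancel the `1`.
        sum_range_eq_add_top (L := fun i => topCoeff T (X ^ i)) hL hL1 (e' := fun _ => 0) 0
          (by omega) (fun j _ _ => by omega) (by omega) (fun j hj => by omega),
        Finset.sum_range_zero, zero_add,
        sum_range_eq_zero (L := fun i => topCoeff T (X ^ i)) hL (fun j _ => by omega),
        sum_range_eq_add_top (L := fun i => topCoeff T (X ^ i)) hL hL1
          (e' := fun j => T.card - ℓ - 3 + (ℓ + R + 2) - j) R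
          (by omega) (fun j _ _ => by omega) (by omega) (fun j hj => by omega), hbR, ha0]
      field_simp
      ring
  -- For the rows of `gMatrix` all products with code functions, twist included, have exponent at
  -- most `s - 2`.
  · refine mem_dualCode_oddCode hinj hT hD hγ hℓ (fun j hj => ?_) (fun j hj _ => ?_) ?_
    · rw [mul_zero, map_zero]
    · rw [add_zero, topCoeff_X_pow_mul_X_pow (by omega)]
    · rw [add_zero, topCoeff_X_pow_mul_X_pow (by omega), mul_zero, map_zero, mul_zero, add_zero]
  · refine mem_dualCode_oddCode hinj hT hD hγ hℓ (fun i hi => ?_) (fun i hi _ => ?_) ?_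
    · rw [topCoeff_X_pow_mul_X_pow (by omega)]
    · rw [zero_add, topCoeff_X_pow_mul_X_pow (by omega)]
    · rw [zero_add, topCoeff_X_pow_mul_X_pow (by omega), topCoeff_X_pow_mul_X_pow (by omega),
        mul_zero, add_zero]

theorem isParityCheckMatrix_even (hinj : Function.Injective fun m => (α m, β m))
    (hT : ∀ a ∈ T, ∃ b : K, b ^ 2 + b = f.eval a)
    (hD : ∀ a b : K, (∃ m, α m = a ∧ β m = b) ↔ a ∈ T ∧ b ^ 2 + b = f.eval a)
    (hγ : ∀ m, γ m = (∏ c ∈ T.erase (α m), (α m - c))⁻¹) (hγ0 : ∀ m, γ m ≠ 0)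
    {k ℓ : ℕ} {η : K} (hk : 3 ≤ k) (heven : Even k) (hkn : k + 2 ≤ n) (hη : η ≠ 0)
    (hℓ : ℓ ≤ k / 2) {e h : ℕ → K} (hrec : EvenRecursion γ α β T.card k ℓ η e h) :
    IsParityCheckMatrix (extendedMatrix γ α β (evenPoly T.card k ℓ e h) (n - k - 1))
      (evenCode α β k ℓ η) := by
  have hn := card_points hinj hT hD
  have hL : ∀ i, i + 1 < T.card → topCoeff T (X ^ i) = 0 := fun i => topCoeff_X_pow_of_lt
  have hL1 : topCoeff T (X ^ (T.card - 1)) = 1 := topCoeff_X_pow_card_sub_one (by omega)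
  obtain ⟨κ, rfl⟩ : ∃ κ, k = 2 * κ := by
    obtain ⟨t, rfl⟩ := heven; exact ⟨t, by omega⟩
  obtain ⟨R, rfl⟩ : ∃ R, κ = ℓ + R := ⟨κ - ℓ, by omega⟩
  have hR : 2 * (ℓ + R) / 2 - ℓ = R := by omega
  have hk2 : (2 * (ℓ + R) - 2) / 2 = ℓ + R - 1 := by omega
  simp only [EvenRecursion, powerSum_one hinj hT hD hγ, powerSum_two hinj hT hD hγ,
    hL1, div_one, mul_one, hR, hk2] at hrec
  obtain ⟨hh0, hh, he, heR⟩ := hrec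
  set U : K[X] := ∑ i ∈ Finset.range (R + 1), C (e i) * X ^ (T.card - ℓ - i) with hU
  set V : K[X] := ∑ j ∈ Finset.range (R + 1), C (h j) * X ^ (T.card - ℓ - 1 - j) with hV
  have hg : ∀ m, MvPolynomial.eval ![α m, β m] (evenPoly T.card (2 * (ℓ + R)) ℓ e h) =
      U.eval (α m) + V.eval (α m) * β m := fun m => by
    simp [evenPoly, hU, hV, eval_finsetSum, Finset.sum_mul, add_comm]
  refine isParityCheckMatrix_of_card
    (linearIndependent_extendedMatrix hT hD hγ0 hg (N := T.card - ℓ - 1) (by omega) (by omega)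
      (Or.inr ⟨degree_sum_lt (fun i _ => by omega) (by omega), ?_, by omega⟩))
    (extendedMatrix_mem hg ?_ (fun i hi => ?_) fun j hj => ?_)
    (linearIndependent_evenRow hT hD ℓ ((2 * (ℓ + R) - 2) / 2) η
      (p := 2 * (ℓ + R) / 2 + 1) (q := (2 * (ℓ + R) - 4) / 2 + 1)
      (by omega) (by omega))
    (evenRow_mem _ _ _) (by simp only [Fintype.card_sum, Fintype.card_fin, Fintype.card_unit]; omega)
  · rw [hV, coeff_sum_top (by omega) (fun j _ => by omega), hh0]
    exact one_ne_zero
  · refine mem_dualCode_evenCode hinj hT hD hγ hℓ (fun j hj => ?_) (fun i hi hne => ?_) ?_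
    · rw [hU, hV, mul_add, map_add, topCoeff_X_pow_mul_sum, topCoeff_X_pow_mul_sum]
      exact even_sum_e_add_sum_h_eq_zero (L := fun i => topCoeff T (X ^ i)) hL hL1 (by omega) he
        (by omega)
    · rw [hV, topCoeff_X_pow_mul_sum]
      exact even_sum_h_eq_zero (L := fun i => topCoeff T (X ^ i)) hL hL1 (by omega) hh (by omega)
        hne
    · rw [hk2, hU, hV, mul_add, map_add, topCoeff_X_pow_mul_sum, topCoeff_X_pow_mul_sum,
        topCoeff_X_pow_mul_sum,
        sum_range_eq_add_top (L := fun i => topCoeff T (X ^ i)) hL hL1 (e' := fun _ => 0) 0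
          (by omega) (fun j _ _ => by omega) (by omega) (fun j hj => by omega),
        Finset.sum_range_zero, zero_add,
        sum_range_eq_add_top (L := fun i => topCoeff T (X ^ i)) hL hL1 (c := e)
          (e' := fun j => T.card - ℓ + (ℓ + R - 1) - j) R
          (by omega) (fun j _ _ => by omega) (by omega) (fun j hj => by omega),
        -- The term in `h R` has exponent `s - 2` and drops out, matching the range `R` in the
        -- formula for `e R`.
        sum_range_eq_of_vanishing (L := fun i => topCoeff T (X ^ i)) hL (c := h) R (by omega)
          (fun j _ _ => by omega),
        sum_range_congr_index (L := fun i => topCoeff T (X ^ i)) (c := h)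
          (e' := fun j => T.card - ℓ - 1 + (ℓ + R - 1) - j) (fun j _ => by omega), heR, hh0]
      field_simp
      ring
  · refine mem_dualCode_evenCode hinj hT hD hγ hℓ (fun j hj => ?_) (fun j hj _ => ?_) ?_
    · rw [add_zero, topCoeff_X_pow_mul_X_pow (by omega)]
    · rw [mul_zero, map_zero]
    · rw [add_zero, topCoeff_X_pow_mul_X_pow (by omega), mul_zero, map_zero, mul_zero, add_zero]
  · refine mem_dualCode_evenCode hinj hT hD hγ hℓ (fun i hi => ?_) (fun i hi _ => ?_) ?_
    · rw [zero_add, topCoeff_X_pow_mul_X_pow (by omega)]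
    · rw [topCoeff_X_pow_mul_X_pow (by omega)]
    · rw [zero_add, topCoeff_X_pow_mul_X_pow (by omega), topCoeff_X_pow_mul_X_pow (by omega),
        mul_zero, add_zero]

end Main
end TECC

theorem mainTheorem6 {K F : Type*} [Field K] [Finite K] [CharP K 2] [Field F] [Algebra K F]
    (f : Polynomial K) (hf : f.natDegree = 3)
    (x y : F) (hx : Transcendental K x) (hxy : y ^ 2 + y = Polynomial.aeval x f)
    (hF : IntermediateField.adjoin K {x, y} = ⊤)
    (n s : ℕ) (hn : n = 2 * s)
    (T : Finset K) (hT : ∀ a ∈ T, ∃ b : K, b ^ 2 + b = f.eval a)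
    (α β : Fin n → K) (hinj : Function.Injective fun m => (α m, β m))
    (hD : ∀ a b : K, (∃ m, α m = a ∧ β m = b) ↔ a ∈ T ∧ b ^ 2 + b = f.eval a)
    (γ : Fin n → K)
    (hγ : ∀ m, TECC.HasResidue (TECC.localRingAt x y (α m) (β m))
      ((∏ a ∈ T, (x - algebraMap K F a))⁻¹ • KaehlerDifferential.D K F x) (γ m))
    (k : ℕ) (hk : 3 ≤ k) (hkn : k + 2 ≤ n) (η : K) (hη : η ≠ 0) :
    TECC.powerSum γ α β (s - 1) 1 ≠ 0 ∧
    (Odd k → ∀ ℓ ≤ (k - 3) / 2, ∀ a b : ℕ → K, TECC.OddRecursion γ α β s k ℓ η a b →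
      TECC.IsParityCheckMatrix
        (TECC.extendedMatrix γ α β (TECC.oddPoly s k ℓ a b) (n - k - 1))
        (TECC.oddCode α β k ℓ η)) ∧
    (Even k → ∀ ℓ ≤ k / 2, ∀ e h : ℕ → K, TECC.EvenRecursion γ α β s k ℓ η e h →
      TECC.IsParityCheckMatrix
        (TECC.extendedMatrix γ α β (TECC.evenPoly s k ℓ e h) (n - k - 1))
        (TECC.evenCode α β k ℓ η)) := by
  classical
  have hP : ∀ m, α m ∈ T ∧ β m ^ 2 + β m = f.eval (α m) := fun m =>
    (hD (α m) (β m)).mp ⟨m, rfl, rfl⟩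
  have hγ' : ∀ m, γ m = (∏ c ∈ T.erase (α m), (α m - c))⁻¹ := fun m =>
    TECC.residue_eq_prod_inv hf hx hxy hF (hP m).1 (hP m).2 (hγ m)
  have hγ0 : ∀ m, γ m ≠ 0 := fun m => by
    rw [hγ' m]
    exact inv_ne_zero <| Finset.prod_ne_zero_iff.mpr fun c hc =>
      sub_ne_zero.mpr (Finset.ne_of_mem_erase hc).symm
  have hcard := TECC.card_points hinj hT hD
  -- Each element of `T` carries exactly two points, so `n = 2 |T|`.
  obtain rfl : s = T.card := by omega
  refine ⟨?_, fun hodd ℓ hℓ a b h => ?_, fun heven ℓ hℓ e h hrec => ?_⟩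
  · rw [TECC.powerSum_one hinj hT hD hγ', TECC.topCoeff_X_pow_card_sub_one (by omega)]
    exact one_ne_zero
  · exact TECC.isParityCheckMatrix_odd hinj hT hD hγ' hγ0 hk hodd hkn hη hℓ h
  · exact TECC.isParityCheckMatrix_even hinj hT hD hγ' hγ0 hk heven hkn hη hℓ hrec
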